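/- An input of the Tree-Residue Vertex-Breaking problem (TRVB) is a finite undirected multigraph $G$ (loops and parallel edges allowed, no vertices of degree $0$) whose vertices are partitioned into breakable and unbreakable ones. Breaking a vertex of degree $k$ replaces it by $k$ new vertices of degree $1$, one for each incident edge end, so that a loop counts twice. TRVB asks whether there is a set $S$ of breakable vertices such that breaking all vertices of $S$ turns $G$ into a tree. For sets $B, U$ of positive integers, $(B,U)$-TRVB is TRVB restricted to inputs in which every breakable vertex has degree in $B$ and every unbreakable vertex has degree in $U$. In Planar $(B,U)$-TRVB, Graph $(B,U)$-TRVB and Planar Graph $(B,U)$-TRVB, the multigraph is in addition required to be planar, simple, or both. Planarity is understood combinatorially: there is a choice of a cyclic order of the edge ends around each vertex whose faces satisfy Euler's formula $V-E+F=2$ on every connected component. Then the following hold. 1. Checking a certificate takes polynomial time: given (encodings of) an input $G$ of TRVB and a set $S$ of vertices, it can be decided in deterministic polynomial time whether $S$ consists of breakable vertices and breaking all vertices of $S$ in $G$ yields a tree. 2. TRVB is in NP. Moreover, for all sets $B, U$ in which membership of a number $n$ can be decided in time polynomial in $n$, the problems $(B,U)$-TRVB, Planar $(B,U)$-TRVB,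 Graph $(B,U)$-TRVB and Planar Graph $(B,U)$-TRVB are in NP. -/

import Mathlib

namespace TRVB

/-! ### Polynomial time and NP -/

/-- The predicate `P` on `α` is decidable in deterministic polynomial time: some Turing machine
(Mathlib's multi-stack machines with finite control), started on the string encoding `a`, outputs
the truth value of `P a` after a number of steps that is polynomial in the length of that string. -/
def PolyTimeDecidable {α Γ : Type} (ea : Computability.Encoding α Γ) (P : α → Prop) : Prop :=
  ∃ f : α → Bool, (∀ a, f a = true ↔ P a) ∧
    Nonempty (Turing.TM2ComputableInPolyTime ea.encode Computability.encodeBool f)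

/-- The encoding of a pair (input string, certificate string): the two strings are written one
after the other, over disjoint copies of the two alphabets. -/
abbrev pairEncoding (Γ : Type) : Computability.Encoding (List Γ × List Bool) (Γ ⊕ Bool) :=
  Computability.encodingProd (Computability.encodingList Γ) (Computability.encodingList Bool)

/-- The class NP: membership of `x` in `L` is witnessed by a certificate whose length is
polynomial in the length of `x` and which is checked in polynomial time. -/
def InNP {Γ : Type} (L : Language Γ) : Prop :=
  ∃ (p : Polynomial ℕ) (R : List Γ → List Bool → Prop),
    PolyTimeDecidable (pairEncoding Γ) (fun z => R z.1 z.2) ∧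
      ∀ x : List Γ, x ∈ L ↔ ∃ w : List Bool, w.length ≤ p.eval x.length ∧ R x w

/-! ### Multigraphs -/

/-- An undirected multigraph with vertex type `V` and edge type `E`; loops and parallel edges are
allowed. Each edge `e` has two half-edges `(e, false)` and `(e, true)`, and `endpoint` gives the
vertex to which a half-edge is attached. (The two half-edges are named so that both halves of a
loop can be told apart when its vertex is broken; the naming carries no other information.) -/
structure Multigraph (V E : Type) where
  endpoint : E × Bool → V

namespace Multigraph

variable {V E : Type}

/-- The multigraph as an object of Mathlib's type of multigraphs. -/
def toGraph (G : Multigraph V E) : Graph V E where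
  vertexSet := Set.univ
  IsLink e x y := s(G.endpoint (e, false), G.endpoint (e, true)) = s(x, y)
  isLink_symm := fun _ _ => ⟨fun x y h => by rw [h]; exact Sym2.eq_swap⟩
  eq_or_eq_of_isLink_of_isLink := fun e x y v w h h' => by
    rw [h] at h'
    rcases Sym2.eq_iff.mp h' with ⟨h1, _⟩ | ⟨h1, _⟩
    · exact Or.inl h1
    · exact Or.inr h1
  left_mem_of_isLink := fun _ _ _ _ => Set.mem_univ _

/-- The degree of a vertex: the number of half-edges attached to it, so a loop counts twice. -/
noncomputable def degree (G : Multigraph V E) (v : V) : ℕ :=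
  Nat.card {h : E × Bool // G.endpoint h = v}

/-- `G` is a simple graph: it has neither loops nor parallel edges. -/
def IsSimple (G : Multigraph V E) : Prop := G.toGraph.Simple

/-- `G` contains a cycle: distinct vertices `c 0, …, c k` and distinct edges `f 0, …, f k`, where
`f i` joins `c i` to `c (i + 1)` (indices modulo `k + 1`). A loop is a cycle with `k = 0`, and a
pair of parallel edges is a cycle with `k = 1`. -/
def HasCycle (G : Multigraph V E) : Prop :=
  ∃ (k : ℕ) (c : Fin (k + 1) → V) (f : Fin (k + 1) → E),
    Function.Injective c ∧ Function.Injective f ∧ ∀ i, G.toGraph.IsLink (f i) (c i) (c (i + 1))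

/-- A tree: a nonempty connected multigraph without cycles. -/
def IsTree (G : Multigraph V E) : Prop :=
  Nonempty V ∧ (∀ x y : V, Relation.ReflTransGen G.toGraph.Adj x y) ∧ ¬ G.HasCycle

open Classical in
/-- Breaking every vertex of `S`: the vertices of `S` are removed, and each half-edge `h` that was
attached to one of them is attached to its own new vertex, which has degree one. -/
noncomputable def breakVertices (G : Multigraph V E) (S : Set V) :
    Multigraph ({v : V // v ∉ S} ⊕ {h : E × Bool // G.endpoint h ∈ S}) E where
  endpoint h :=
    if hS : G.endpoint h ∈ S then Sum.inr ⟨h, hS⟩ else Sum.inl ⟨G.endpoint h, hS⟩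

/-- The permutation of the half-edges that exchanges the two halves of every edge. -/
def flip (E : Type) : Equiv.Perm (E × Bool) := (Equiv.refl E).prodCongr Equiv.boolNot

/-- A rotation system: for every vertex `v`, a cyclic order of the half-edges at `v`. It is given
by the permutation sending each half-edge to the next one around its vertex. -/
def IsRotationSystem (G : Multigraph V E) (σ : Equiv.Perm (E × Bool)) : Prop :=
  ∀ h h' : E × Bool, σ.SameCycle h h' ↔ G.endpoint h = G.endpoint h'

/-- The number of faces of a rotation system. A face boundary is traced by repeatedly crossing
to the other half of the current edge and then turning to the next half-edge around the vertex
reached. An isolated vertex has no half-edge to trace, and has one face around it. -/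
noncomputable def faceCount (G : Multigraph V E) (σ : Equiv.Perm (E × Bool)) : ℕ :=
  Nat.card (Quotient (Equiv.Perm.SameCycle.setoid (σ * flip E))) +
    Nat.card {v : V // ∀ h, G.endpoint h ≠ v}

/-- The number of connected components. -/
noncomputable def componentCount (G : Multigraph V E) : ℕ := Nat.card (Quot G.toGraph.Adj)

/-- A finite multigraph is planar if it has a combinatorial embedding in the sphere: a rotation
system satisfying Euler's formula `#V - #E + #F = 2` on every component. The left side never
exceeds `2` on a component, so it is enough to ask for the sum of these equations. -/
def IsPlanar (G : Multigraph V E) : Prop :=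
  ∃ σ : Equiv.Perm (E × Bool), G.IsRotationSystem σ ∧
    Nat.card V + G.faceCount σ = Nat.card E + 2 * G.componentCount

end Multigraph

/-! ### Inputs and their encoding -/

/-- A finite multigraph with vertices `0, …, n - 1` whose edges are given by a list of pairs of
ends (with repetitions for parallel edges), and with each vertex marked as breakable or not. -/
structure Input where
  n : ℕ
  breakable : Fin n → Bool
  edges : List (Fin n × Fin n)

namespace Input

/-- The multigraph of an input. -/
def graph (I : Input) : Multigraph (Fin I.n) (Fin I.edges.length) where
  endpoint h := if h.2 then (I.edges.get h.1).2 else (I.edges.get h.1).1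

/-- Every vertex has positive degree. -/
def NoIsolatedVertices (I : Input) : Prop := ∀ v, 0 < I.graph.degree v

/-- Breakable vertices have degrees in `B`, and unbreakable vertices have degrees in `U`. -/
def DegreesIn (B U : Set ℕ) (I : Input) : Prop :=
  ∀ v, if I.breakable v then I.graph.degree v ∈ B else I.graph.degree v ∈ U

/-- `S` consists of breakable vertices, and breaking all of them leaves a tree. -/
def IsSolution (I : Input) (S : Finset (Fin I.n)) : Prop :=
  (∀ v ∈ S, I.breakable v = true) ∧ (I.graph.breakVertices (S : Set (Fin I.n))).IsTree

end Input

/-- The alphabet in which inputs are written. -/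
inductive Symbol
  | breakable
  | unbreakable
  | tick
  | sep
  deriving DecidableEq

/-- A vertex number `k` is written as `k` ticks and a separator. -/
def encodeIndex (k : ℕ) : List Symbol := List.replicate k Symbol.tick ++ [Symbol.sep]

/-- An input is written as one mark for each vertex, followed by the list of edges, each given by
its two ends. (The string has at least one symbol for each vertex and each edge, and fewer than
`n + 2 * m * (n + 1) + 1` symbols for `n` vertices and `m` edges. So writing vertex numbers in
unary changes its length only polynomially.) -/
def Input.encode (I : Input) : List Symbol :=
  List.ofFn (fun v => if I.breakable v then Symbol.breakable else Symbol.unbreakable) ++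
    I.edges.flatMap (fun e => encodeIndex e.1 ++ encodeIndex e.2)

theorem encodeEdges_inj : ∀ (l l' : List (ℕ × ℕ)),
    l.flatMap (fun e => encodeIndex e.1 ++ encodeIndex e.2) =
      l'.flatMap (fun e => encodeIndex e.1 ++ encodeIndex e.2) → l = l' := by
  have key : ∀ (k k' : ℕ) (s s' : List Symbol), encodeIndex k ++ s = encodeIndex k' ++ s' →
      k = k' ∧ s = s' := by
    intro k
    induction k with
    | zero =>
      intro k' s s' h
      cases k' <;> simp_all [encodeIndex, List.replicate_succ]
    | succ k ih =>
      intro k' s s' h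
      cases k' with
      | zero => simp_all [encodeIndex, List.replicate_succ]
      | succ k' =>
        have := ih k' s s' (by simpa [encodeIndex, List.replicate_succ] using h)
        simpa using this
  intro l
  induction l with
  | nil =>
    intro l' h
    cases l' <;> simp_all [encodeIndex]
  | cons a l ih =>
    intro l' h
    cases l' with
    | nil => simp_all [encodeIndex]
    | cons b l' =>
      simp only [List.flatMap_cons, List.append_assoc] at h
      obtain ⟨h1, h2⟩ := key _ _ _ _ h
      obtain ⟨h3, h4⟩ := key _ _ _ _ h2
      rw [ih _ h4, Prod.ext h1 h3]

theorem append_split_inj (l l' t t' : List Symbol) (h : l ++ t = l' ++ t')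
   (p : Symbol → Bool) (hl : ∀ s ∈ l, p s) (hl' : ∀ s ∈ l', p s)
   (ht : ∀ s ∈ t, ¬ p s) (ht' : ∀ s ∈ t', ¬ p s) : l = l' ∧ t = t' := by
  have h1 : (l ++ t).filter p = l := by
    rw [List.filter_append, List.filter_eq_self.2 hl, List.filter_eq_nil_iff.2 ht, List.append_nil]
  have h2 : (l' ++ t').filter p = l' := by
    rw [List.filter_append, List.filter_eq_self.2 hl', List.filter_eq_nil_iff.2 ht', List.append_nil]
  have : l = l' := by rw [← h1, ← h2, h]
  subst this
  exact ⟨rfl, List.append_cancel_left h⟩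

/-- Different inputs are written as different strings. -/
theorem encode_injective : Function.Injective Input.encode := by
  rintro ⟨n, b, E⟩ ⟨n', b', E'⟩ h
  have := append_split_inj _ _ _ _ h (fun s => decide (s = .breakable ∨ s = .unbreakable))
    (by simp [List.mem_ofFn]) (by simp [List.mem_ofFn])
    (by simp [encodeIndex] <;> grind) (by simp [encodeIndex] <;> grind)
  obtain ⟨h1, h2⟩ := this
  have hn : n = n' := by simpa using congrArg List.length h1
  subst hn
  have hb : b = b' := by
    have := List.ofFn_injective h1
    funext v
    have := congrFun this v
    change (if b v = true then Symbol.breakable else Symbol.unbreakable) =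
      (if b' v = true then Symbol.breakable else Symbol.unbreakable) at this
    cases h : b v <;> cases h' : b' v <;> simp_all
  have hE : E.map (fun e => ((e.1 : ℕ), (e.2 : ℕ))) = E'.map (fun e => ((e.1 : ℕ), (e.2 : ℕ))) := by
    apply encodeEdges_inj
    simpa [List.flatMap_map] using h2
  have hE' : E = E' := List.map_injective_iff.2 (by
    rintro ⟨a, b⟩ ⟨c, d⟩ h; simpa [Fin.ext_iff] using h) hE
  rw [hb, hE']

/-- A set of vertices is written as its characteristic bit string. -/
def encodeVertexSet {n : ℕ} (S : Finset (Fin n)) : List Bool :=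
  List.ofFn (fun v => decide (v ∈ S))

/-- Certificate checking for TRVB: `x` encodes an input without isolated vertices, and `w` encodes
a set of breakable vertices of it such that breaking all of them leaves a tree. -/
def IsCertificate (x : List Symbol) (w : List Bool) : Prop :=
  ∃ (I : Input) (S : Finset (Fin I.n)), x = I.encode ∧ w = encodeVertexSet S ∧
    I.NoIsolatedVertices ∧ I.IsSolution S

/-! ### The problems -/

/-- TRVB restricted to the inputs that satisfy the constraint `C`, as a language. -/
def restrictedTRVB (C : Input → Prop) : Language Symbol :=
  {x | ∃ I : Input, x = I.encode ∧ I.NoIsolatedVertices ∧ C I ∧ ∃ S, I.IsSolution S}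

/-- TRVB. -/
def trvb : Language Symbol := restrictedTRVB fun _ => True

/-- `(B, U)`-TRVB. -/
def trvbBU (B U : Set ℕ) : Language Symbol := restrictedTRVB fun I => I.DegreesIn B U

/-- Planar `(B, U)`-TRVB. -/
def planarTRVB (B U : Set ℕ) : Language Symbol :=
  restrictedTRVB fun I => I.DegreesIn B U ∧ I.graph.IsPlanar

/-- Graph `(B, U)`-TRVB. -/
def graphTRVB (B U : Set ℕ) : Language Symbol :=
  restrictedTRVB fun I => I.DegreesIn B U ∧ I.graph.IsSimple

/-- Planar Graph `(B, U)`-TRVB. -/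
def planarGraphTRVB (B U : Set ℕ) : Language Symbol :=
  restrictedTRVB fun I => I.DegreesIn B U ∧ I.graph.IsPlanar ∧ I.graph.IsSimple

/-- Membership in `A` is computable in pseudopolynomial time: in time polynomial in the number. -/
def PseudoPolyTimeDecidable (A : Set ℕ) : Prop :=
  PolyTimeDecidable Computability.unaryEncodingNat (fun k => k ∈ A)

end TRVB

/-! The mathematical content is small. A finite multigraph is a tree iff it has exactly one
component and one vertex more than edges. Components are found by processing the edges one by one,
giving all vertices with the label of one end the label of the other. An edge either merges two
classes or closes a cycle, so the number of classes is at least `V - E`, with equality iff there is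
no cycle (`card_label`, `Multigraph.isTree_iff`). The broken graph is handled without building it: a
vertex left whole keeps its number `v`, and the new vertex of half-edge `i` gets the number `n + i`
(`Input.isTree_iff`). This checks a set `S`, and `S` itself is the certificate for TRVB. Degrees and
simplicity are read off the list of edge ends. For planarity the certificate also contains a
rotation system, as a table of images of half-edges. The same merging of labels counts the cycles of
a permutation, hence the faces, and so verifies Euler's formula (`Input.isPlanarRotation_iff`). Most
of the work is to show that all this runs on a multi-stack Turing machine in polynomial time. Data
are binary trees, kept in prefix code on one main stack; a few auxiliary stacks suffice to
duplicate, swap and delete the top trees. Code is composed from fragments that start and end in the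
same internal state, with only the main stack in use. A `PolyFun` comes with a polynomial bound on
the size of its value besides one on its time, which is what composition needs. These functions are
closed under pairing, case distinction (`PolyFun.cases`) and iteration with polynomially bounded
intermediate values (`PolyFun.iterate`). Everything else, from arithmetic to folds over lists, is
derived from that, and `PolyFun.tm2` turns the result into a machine. Membership in `B` and `U` is
given only by machines. These are embedded as subroutines with stacks and state of their own
(`PolyFun.call`) and are run on degrees written in unary. -/

namespace PolyTime

open Turing

/-! ### Binary trees as data -/

/-- Binary trees, the data type in which all values are represented. -/
inductive Bin
  | leaf
  | node (l r : Bin)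

namespace Bin

/-- The prefix code of a tree. -/
def ser : Bin → List Bool
  | leaf => [false]
  | node l r => true :: (l.ser ++ r.ser)

/-- The number of nodes and leaves of a tree. -/
def size (t : Bin) : ℕ := t.ser.length

@[simp] theorem size_leaf : size leaf = 1 := rfl

@[simp] theorem size_node (l r : Bin) : size (node l r) = l.size + r.size + 1 := by
  simp [size, ser]

theorem size_pos (t : Bin) : 0 < t.size := by cases t <;> simp

/-- The length of the rightmost branch of a tree. -/
def spine : Bin → ℕ
  | leaf => 0
  | node _ r => r.spine + 1

end Bin

/-! ### Machines -/

instance (tm : FinTM2) : Fintype tm.σ := tm.σFin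
instance (tm : FinTM2) : Fintype tm.Λ := tm.ΛFin
instance (tm : FinTM2) : Fintype tm.K := tm.kFin

/-- The input alphabet of a machine, and a finite family of machines that it may use as
subroutines. -/
structure Ambient where
  /-- the input alphabet -/
  A : Type
  [fintypeA : Fintype A]
  /-- the index type of the subroutines -/
  ι : Type
  [decEq : DecidableEq ι]
  [fintypeI : Fintype ι]
  /-- the functions computed by the subroutines -/
  f : ι → ℕ → Bool
  /-- the subroutines -/
  comp : ∀ i, TM2ComputableInPolyTime Computability.unaryEncodingNat.encode
    Computability.encodeBool (f i)

/-- The machine that is used as a subroutine. -/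
abbrev Ambient.tm (𝔸 : Ambient) (i : 𝔸.ι) : FinTM2 := (𝔸.comp i).tm

attribute [instance] Ambient.fintypeA Ambient.decEq Ambient.fintypeI

/-- The stacks of a machine, apart from those of its subroutines. -/
inductive Stk
  | inp
  | out
  | main
  | aux₁
  | aux₂
  | ctr
  deriving DecidableEq

instance : Fintype Stk where
  elems := {.inp, .out, .main, .aux₁, .aux₂, .ctr}
  complete := by rintro ⟨⟩ <;> simp

namespace Ambient

variable (𝔸 : Ambient)

/-- The index type of all stacks. -/
abbrev K : Type := Stk ⊕ (Σ i : 𝔸.ι, (𝔸.tm i).K)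

/-- The stack alphabets. -/
@[reducible] def Γ : 𝔸.K → Type
  | .inl .inp => 𝔸.A
  | .inl .out => Bool
  | .inl .main => Bool
  | .inl .aux₁ => Bool
  | .inl .aux₂ => Bool
  | .inl .ctr => Bool
  | .inr ⟨i, k⟩ => (𝔸.tm i).Γ k

/-- The internal states: two registers for symbols, and the states of the subroutines. -/
abbrev State : Type := Option Bool × Option 𝔸.A × ∀ i, (𝔸.tm i).σ

/-- The initial internal state. -/
def v₀ : 𝔸.State := (none, none, fun i => (𝔸.tm i).initialState)

/-- Stack contents. -/
abbrev Store : Type := ∀ k : 𝔸.K, List (𝔸.Γ k)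

/-- Statements with labels in `L`. -/
abbrev Stm (L : Type) : Type := TM2.Stmt 𝔸.Γ L 𝔸.State

/-- Configurations with labels in `L`. -/
abbrev Conf (L : Type) : Type := TM2.Cfg 𝔸.Γ L 𝔸.State

variable {𝔸}

/-- Stack contents given stack by stack. -/
def stAll (i : List 𝔸.A) (o m a b c : List Bool) (T : ∀ j k, List ((𝔸.tm j).Γ k)) : 𝔸.Store
  | .inl .inp => i
  | .inl .out => o
  | .inl .main => m
  | .inl .aux₁ => a
  | .inl .aux₂ => b
  | .inl .ctr => c
  | .inr ⟨j, k⟩ => T j k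

section
variable (i : List 𝔸.A) (o m a b c : List Bool) (T : ∀ j k, List ((𝔸.tm j).Γ k))

@[simp] theorem stAll_inp : stAll i o m a b c T (.inl .inp) = i := rfl
@[simp] theorem stAll_out : stAll i o m a b c T (.inl .out) = o := rfl
@[simp] theorem stAll_main : stAll i o m a b c T (.inl .main) = m := rfl
@[simp] theorem stAll_aux₁ : stAll i o m a b c T (.inl .aux₁) = a := rfl
@[simp] theorem stAll_aux₂ : stAll i o m a b c T (.inl .aux₂) = b := rfl
@[simp] theorem stAll_ctr : stAll i o m a b c T (.inl .ctr) = c := rfl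
@[simp] theorem stAll_inr (j : 𝔸.ι) (k : (𝔸.tm j).K) :
    stAll i o m a b c T (.inr ⟨j, k⟩) = T j k := rfl

@[simp] theorem update_inp (x : List 𝔸.A) :
    Function.update (stAll i o m a b c T) (.inl .inp) x = stAll x o m a b c T := by
  funext k; rcases k with (_ | _) | _ <;> simp [Function.update] <;> rfl
@[simp] theorem update_out (x : List Bool) :
    Function.update (stAll i o m a b c T) (.inl .out) x = stAll i x m a b c T := by
  funext k; rcases k with (_ | _) | _ <;> simp [Function.update] <;> rfl
@[simp] theorem update_main (x : List Bool) :
    Function.update (stAll i o m a b c T) (.inl .main) x = stAll i o x a b c T := by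
  funext k; rcases k with (_ | _) | _ <;> simp [Function.update] <;> rfl
@[simp] theorem update_aux₁ (x : List Bool) :
    Function.update (stAll i o m a b c T) (.inl .aux₁) x = stAll i o m x b c T := by
  funext k; rcases k with (_ | _) | _ <;> simp [Function.update] <;> rfl
@[simp] theorem update_aux₂ (x : List Bool) :
    Function.update (stAll i o m a b c T) (.inl .aux₂) x = stAll i o m a x c T := by
  funext k; rcases k with (_ | _) | _ <;> simp [Function.update] <;> rfl
@[simp] theorem update_ctr (x : List Bool) :
    Function.update (stAll i o m a b c T) (.inl .ctr) x = stAll i o m a b x T := by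
  funext k; rcases k with (_ | _) | _ <;> simp [Function.update] <;> rfl
@[simp] theorem update_inr (j : 𝔸.ι) (k : (𝔸.tm j).K) (x : List ((𝔸.tm j).Γ k)) :
    Function.update (stAll i o m a b c T) (.inr ⟨j, k⟩) x =
      stAll i o m a b c (Function.update T j (Function.update (T j) k x)) := by
  funext k'
  rcases k' with (_ | _) | ⟨j', k'⟩
  any_goals rfl
  by_cases hj : j' = j
  · subst hj
    by_cases hk : k' = k
    · subst hk; simp
    · rw [Function.update_of_ne (by simpa using hk)]
      simp [Function.update_of_ne hk]
  · rw [Function.update_of_ne (by simp; tauto)]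
    simp [Function.update_of_ne hj]

end

/-- Stack contents where the stacks of the subroutines are empty. -/
abbrev st (i : List 𝔸.A) (o m a b c : List Bool) : 𝔸.Store := stAll i o m a b c fun _ _ => []

end Ambient

/-! ### Code fragments and their control flow -/

open Ambient

variable {𝔸 : Ambient}

/-- `Reach M n c d`: the machine `M` takes at most `n` steps from `c` to `d`. -/
def Reach {L : Type} (M : L → 𝔸.Stm L) (n : ℕ) (c d : 𝔸.Conf L) : Prop :=
  ∃ k ≤ n, (flip bind (TM2.step M))^[k] (some c) = some d

namespace Reach

variable {L : Type} {M : L → 𝔸.Stm L} {m n : ℕ} {c d e : 𝔸.Conf L}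

theorem refl : Reach M 0 c c := ⟨0, le_rfl, rfl⟩

theorem mono (h : Reach M m c d) (hmn : m ≤ n) : Reach M n c d :=
  let ⟨k, hk, hc⟩ := h; ⟨k, hk.trans hmn, hc⟩

theorem trans (h : Reach M m c d) (h' : Reach M n d e) : Reach M (m + n) c e := by
  obtain ⟨k, hk, hc⟩ := h
  obtain ⟨l, hl, hd⟩ := h'
  exact ⟨l + k, by omega, by rw [Function.iterate_add_apply, hc, hd]⟩

theorem one (h : TM2.step M c = some d) : Reach M 1 c d :=
  ⟨1, le_rfl, by simpa [flip] using h⟩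

end Reach

variable (𝔸) in
/-- A fragment of code: it uses labels in `Λ`, which are embedded into the label type of the whole
machine, and leaves control to an exit label. -/
structure Frag where
  /-- the labels of the fragment -/
  Λ : Type
  [fin : Fintype Λ]
  /-- the label at which the fragment starts -/
  entry : Λ
  /-- the code, given an embedding of the labels and the exit label -/
  code : ∀ {L : Type}, (Λ → L) → L → Λ → 𝔸.Stm L

attribute [instance] Frag.fin

namespace Frag

/-- In every machine that contains the fragment `c`, control passes from the entry of `c` to
its exit in at most `n` steps, and changes the store from `S` to `S'`. -/
def Runs (c : Frag 𝔸) (S S' : 𝔸.Store) (n : ℕ) : Prop :=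
  ∀ (L : Type) (M : L → 𝔸.Stm L) (emb : Λ c → L) (exit : L),
    (∀ l, M (emb l) = c.code emb exit l) →
      Reach M n ⟨some (emb c.entry), 𝔸.v₀, S⟩ ⟨some exit, 𝔸.v₀, S'⟩

theorem Runs.mono {c : Frag 𝔸} {S S' : 𝔸.Store} {m n : ℕ} (h : c.Runs S S' m) (hmn : m ≤ n) :
    c.Runs S S' n := fun L M emb exit hM => (h L M emb exit hM).mono hmn

/-- A straight-line fragment. -/
def single (q : ∀ {L : Type}, L → 𝔸.Stm L) : Frag 𝔸 where
  Λ := Unit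
  entry := ()
  code _ exit _ := q exit

theorem runs_single {q : ∀ {L : Type}, L → 𝔸.Stm L} {S S' : 𝔸.Store}
    (h : ∀ (L : Type) (e : L), TM2.stepAux (q e) 𝔸.v₀ S = ⟨some e, 𝔸.v₀, S'⟩) :
    (single q).Runs S S' 1 := fun L M emb exit hM =>
  Reach.one (by rw [TM2.step, hM, ← h L exit]; rfl)

/-- Run `c`, then `d`. -/
def seq (c d : Frag 𝔸) : Frag 𝔸 where
  Λ := c.Λ ⊕ d.Λ
  entry := .inl c.entry
  code emb exit
    | .inl l => c.code (fun x => emb (.inl x)) (emb (.inr d.entry)) l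
    | .inr l => d.code (fun x => emb (.inr x)) exit l

theorem Runs.seq {c d : Frag 𝔸} {S S' S'' : 𝔸.Store} {m n : ℕ} (hc : c.Runs S S' m)
    (hd : d.Runs S' S'' n) : (c.seq d).Runs S S'' (m + n) := fun L M emb _ hM =>
  (hc L M (fun x => emb (.inl x)) _ fun l => hM (.inl l)).trans
    (hd L M (fun x => emb (.inr x)) _ fun l => hM (.inr l))

/-- A statement that chooses between its two exits, the first of which leads to `c` and the second
of which leads to `d`. -/
def ite (q : ∀ {L : Type}, L → L → 𝔸.Stm L) (c d : Frag 𝔸) : Frag 𝔸 where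
  Λ := Option (c.Λ ⊕ d.Λ)
  entry := none
  code emb exit
    | none => q (emb (some (.inl c.entry))) (emb (some (.inr d.entry)))
    | some (.inl l) => c.code (fun x => emb (some (.inl x))) exit l
    | some (.inr l) => d.code (fun x => emb (some (.inr x))) exit l

theorem Runs.ite_left {q : ∀ {L : Type}, L → L → 𝔸.Stm L} {c d : Frag 𝔸} {S S' S'' : 𝔸.Store}
    {n : ℕ}
    (hq : ∀ (L : Type) (e f : L), TM2.stepAux (q e f) 𝔸.v₀ S = ⟨some e, 𝔸.v₀, S'⟩)
    (hc : c.Runs S' S'' n) : (ite q c d).Runs S S'' (1 + n) := fun L M emb exit hM =>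
  (Reach.one (by rw [TM2.step, hM, ← hq L _ (emb (some (.inr d.entry)))]; rfl)).trans
    (hc L M (fun x => emb (some (.inl x))) _ fun l => hM (some (.inl l)))

theorem Runs.ite_right {q : ∀ {L : Type}, L → L → 𝔸.Stm L} {c d : Frag 𝔸} {S S' S'' : 𝔸.Store}
    {n : ℕ}
    (hq : ∀ (L : Type) (e f : L), TM2.stepAux (q e f) 𝔸.v₀ S = ⟨some f, 𝔸.v₀, S'⟩)
    (hd : d.Runs S' S'' n) : (ite q c d).Runs S S'' (1 + n) := fun L M emb exit hM =>
  (Reach.one (by rw [TM2.step, hM, ← hq L (emb (some (.inl c.entry)))]; rfl)).trans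
    (hd L M (fun x => emb (some (.inr x))) _ fun l => hM (some (.inr l)))

/-- A statement that chooses between its two exits, the first of which leads to `c` and back. -/
def loop (q : ∀ {L : Type}, L → L → 𝔸.Stm L) (c : Frag 𝔸) : Frag 𝔸 where
  Λ := Option c.Λ
  entry := none
  code emb exit
    | none => q (emb (some c.entry)) exit
    | some l => c.code (fun x => emb (some x)) (emb none) l

theorem runs_loop_exit {q : ∀ {L : Type}, L → L → 𝔸.Stm L} {c : Frag 𝔸} {S S' : 𝔸.Store}
    (hq : ∀ (L : Type) (e f : L), TM2.stepAux (q e f) 𝔸.v₀ S = ⟨some f, 𝔸.v₀, S'⟩) :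
    (loop q c).Runs S S' 1 := fun L M emb exit hM =>
  Reach.one (by rw [TM2.step, hM, ← hq L (emb (some c.entry))]; rfl)

/-- The body returns to the test, so the rest of the run is a run of the same loop. Loops are
analysed by unfolding one pass in this way and inducting on the data. -/
theorem Runs.loop_step {q : ∀ {L : Type}, L → L → 𝔸.Stm L} {c : Frag 𝔸}
    {S S₁ S₂ S' : 𝔸.Store} {m n : ℕ}
    (hq : ∀ (L : Type) (e f : L), TM2.stepAux (q e f) 𝔸.v₀ S = ⟨some e, 𝔸.v₀, S₁⟩)
    (hc : c.Runs S₁ S₂ m) (h : (loop q c).Runs S₂ S' n) :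
    (loop q c).Runs S S' (1 + m + n) := fun L M emb exit hM =>
  ((Reach.one (by rw [TM2.step, hM, ← hq L _ exit]; rfl)).trans
    (hc L M (fun x => emb (some x)) (emb none) fun l => hM (some l))).trans (h L M emb exit hM)

end Frag

end PolyTime

/-! ### Stack operations on trees in prefix code -/

namespace PolyTime

open Turing Ambient

variable {𝔸 : Ambient}

open TM2.Stmt

namespace Frag

/-- Put a symbol into the register. -/
abbrev reg (v : 𝔸.State) (b : Option Bool) : 𝔸.State := (b, v.2)

/-- The fragment that does nothing. -/
def skip : Frag 𝔸 := single fun e => goto fun _ => e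

theorem runs_skip (S : 𝔸.Store) : skip.Runs S S 1 := runs_single fun _ _ => rfl

/-- A loop with empty body that moves symbols one by one. -/
theorem runs_drain {q : ∀ {L : Type}, L → L → 𝔸.Stm L} (F : List Bool → List Bool → 𝔸.Store)
    (hstep : ∀ (L : Type) (e f : L) x l m,
      TM2.stepAux (q e f) 𝔸.v₀ (F (x :: l) m) = ⟨some e, 𝔸.v₀, F l (x :: m)⟩)
    (hexit : ∀ (L : Type) (e f : L) m,
      TM2.stepAux (q e f) 𝔸.v₀ (F [] m) = ⟨some f, 𝔸.v₀, F [] m⟩) (l m : List Bool) :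
    (loop q skip).Runs (F l m) (F [] (l.reverse ++ m)) (2 * l.length + 1) := by
  induction l generalizing m with
  | nil => exact runs_loop_exit fun L e f => hexit L e f m
  | cons x l ih =>
    have := Runs.loop_step (fun L e f => hstep L e f x l m) (runs_skip _) (ih (x :: m))
    simpa [List.append_assoc] using this.mono (n := 2 * (l.length + 1) + 1) (by omega)

/-- Move the symbols of `aux₁` to `aux₂`. -/
def pour₁₂ : Frag 𝔸 := loop (fun e f => pop (.inl .aux₁) (fun v b => reg v b)
  (branch (fun v => v.1.isSome)
    (push (.inl .aux₂) (fun v => v.1.getD false) (load (fun v => reg v none) (goto fun _ => e)))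
    (goto fun _ => f))) skip

/-- Move the symbols of `aux₂` to `aux₁`. -/
def pour₂₁ : Frag 𝔸 := loop (fun e f => pop (.inl .aux₂) (fun v b => reg v b)
  (branch (fun v => v.1.isSome)
    (push (.inl .aux₁) (fun v => v.1.getD false) (load (fun v => reg v none) (goto fun _ => e)))
    (goto fun _ => f))) skip

/-- Move the symbols of `aux₁` to the main stack. -/
def pour₁ : Frag 𝔸 := loop (fun e f => pop (.inl .aux₁) (fun v b => reg v b)
  (branch (fun v => v.1.isSome)
    (push (.inl .main) (fun v => v.1.getD false) (load (fun v => reg v none) (goto fun _ => e)))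
    (goto fun _ => f))) skip

/-- Move the symbols of `ctr` to the main stack. -/
def pourCtr : Frag 𝔸 := loop (fun e f => pop (.inl .ctr) (fun v b => reg v b)
  (branch (fun v => v.1.isSome)
    (push (.inl .main) (fun v => v.1.getD false) (load (fun v => reg v none) (goto fun _ => e)))
    (goto fun _ => f))) skip

/-- Move the symbols of `aux₂` to both `aux₁` and `ctr`. -/
def fork : Frag 𝔸 := loop (fun e f => pop (.inl .aux₂) (fun v b => reg v b)
  (branch (fun v => v.1.isSome)
    (push (.inl .aux₁) (fun v => v.1.getD false) (push (.inl .ctr) (fun v => v.1.getD false)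
      (load (fun v => reg v none) (goto fun _ => e))))
    (goto fun _ => f))) skip

/-- Delete the symbols of `aux₁`. -/
def clear : Frag 𝔸 := loop (fun e f => pop (.inl .aux₁) (fun v b => reg v b)
  (branch (fun v => v.1.isSome) (load (fun v => reg v none) (goto fun _ => e))
    (goto fun _ => f))) skip

section
variable (i : List 𝔸.A) (o m a b c : List Bool)

theorem runs_pour₁₂ : pour₁₂.Runs (st i o m a b c) (st i o m [] (a.reverse ++ b) c)
    (2 * a.length + 1) :=
  runs_drain (fun a b => st i o m a b c) (by intros; simp [v₀]) (by intros; simp [v₀]) a b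

theorem runs_pour₂₁ : pour₂₁.Runs (st i o m a b c) (st i o m (b.reverse ++ a) [] c)
    (2 * b.length + 1) :=
  runs_drain (fun b a => st i o m a b c) (by intros; simp [v₀]) (by intros; simp [v₀]) b a

theorem runs_pour₁ : pour₁.Runs (st i o m a b c) (st i o (a.reverse ++ m) [] b c)
    (2 * a.length + 1) :=
  runs_drain (fun a m => st i o m a b c) (by intros; simp [v₀]) (by intros; simp [v₀]) a m

theorem runs_pourCtr : pourCtr.Runs (st i o m a b c) (st i o (c.reverse ++ m) a b [])
    (2 * c.length + 1) :=
  runs_drain (fun c m => st i o m a b c) (by intros; simp [v₀]) (by intros; simp [v₀]) c m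

theorem runs_fork : fork.Runs (st i o m [] b []) (st i o m b.reverse [] b.reverse)
    (2 * b.length + 1) := by
  have h : fork.Runs (st i o m [] b []) (st i o m (b.reverse ++ []) [] (b.reverse ++ []))
      (2 * b.length + 1) :=
    -- One list serves as the content of both `aux₁` and `ctr`, which grow together.
    runs_drain (fun b a => st i o m a b a) (by intros; simp [v₀]) (by intros; simp [v₀]) b []
  simpa only [List.append_nil] using h

theorem runs_clear : clear.Runs (st i o m a b c) (st i o m [] b c) (2 * a.length + 1) :=
  -- The symbols go nowhere: the target list of the drain is ignored.
  runs_drain (fun a _ => st i o m a b c) (by intros; simp [v₀]) (by intros; simp [v₀]) a []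

end

/-- Move as many trees from the main stack to `aux₁` as there are symbols on `ctr`. -/
def grabLoop : Frag 𝔸 :=
  loop (fun e f => pop (.inl .ctr) (fun v b => reg v b)
    (branch (fun v => v.1.isSome)
      (pop (.inl .main) (fun v b => reg v b) (push (.inl .aux₁) (fun v => v.1.getD false)
        (branch (fun v => v.1.getD false)
          (push (.inl .ctr) (fun _ => true) (push (.inl .ctr) (fun _ => true)
            (load (fun v => reg v none) (goto fun _ => e))))
          (load (fun v => reg v none) (goto fun _ => e)))))
      (goto fun _ => f))) skip

/-- Move one tree from the main stack to `aux₁`. -/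
def grab : Frag 𝔸 :=
  (single fun e => push (.inl .ctr) (fun _ => true) (goto fun _ => e)).seq
    grabLoop

/-- The stack `ctr` holds one symbol for each subtree still to be read: a leaf uses up one symbol, a
node turns one into two. The tree arrives on `aux₁` in reverse. In `key` the rest of the run is
arbitrary, so that the runs for the two subtrees of a node can be chained. -/
theorem runs_grab (i : List 𝔸.A) (o m a b : List Bool) (t : Bin) :
    grab.Runs (st i o (t.ser ++ m) a b []) (st i o m (t.ser.reverse ++ a) b [])
      (2 * t.size + 2) := by
  have key : ∀ (t : Bin) (m a c : List Bool) (S' : 𝔸.Store) (n : ℕ),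
      grabLoop.Runs (st i o m (t.ser.reverse ++ a) b c) S' n →
      grabLoop.Runs (st i o (t.ser ++ m) a b (true :: c)) S'
          (2 * t.size + n) := by
    intro t
    induction t with
    | leaf =>
      intro m a c S' n h
      refine (Runs.loop_step ?_ (runs_skip _) h).mono (by simp)
      intros; simp [v₀, Bin.ser]
    | node l r ihl ihr =>
      intro m a c S' n h
      refine (Runs.loop_step ?_ (runs_skip _) (ihl (r.ser ++ m) (true :: a) (true :: c) S' _
        (ihr m (l.ser.reverse ++ true :: a) c S' n ?_))).mono (by simp; omega)
      · intros; simp [v₀, Bin.ser]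
      · simpa [Bin.ser] using h
  refine (Runs.seq (runs_single ?_) (key t m a [] _ 1 (runs_loop_exit ?_))).mono (by omega)
  · intros; simp [v₀]
  · intros; simp [v₀]

/-- Duplicate the top tree. -/
def dup : Frag 𝔸 := grab.seq (pour₁₂.seq (fork.seq (pour₁.seq pourCtr)))

/-- Swap the two top trees. -/
def swap : Frag 𝔸 := grab.seq (pour₁₂.seq (grab.seq (pour₂₁.seq pour₁)))

/-- Remove the top tree. -/
def drop : Frag 𝔸 := grab.seq clear

/-- The stores between the basic operations: only the main stack is in use. -/
abbrev sm (m : List Bool) : 𝔸.Store := st [] [] m [] [] []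

/-- Each transfer reverses the code. The fork is applied to the code in its proper order on `aux₂`
and leaves two reversed copies, which the last two transfers straighten out. -/
theorem runs_dup (m : List Bool) (t : Bin) :
    dup.Runs (𝔸 := 𝔸) (sm (t.ser ++ m)) (sm (t.ser ++ (t.ser ++ m))) (10 * t.size + 6) := by
  have h1 := runs_grab (𝔸 := 𝔸) [] [] m [] [] t
  have h2 := runs_pour₁₂ (𝔸 := 𝔸) [] [] m t.ser.reverse [] []
  have h3 := runs_fork (𝔸 := 𝔸) [] [] m t.ser
  have h4 := runs_pour₁ (𝔸 := 𝔸) [] [] m t.ser.reverse [] t.ser.reverse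
  have h5 := runs_pourCtr (𝔸 := 𝔸) [] [] (t.ser ++ m) [] [] t.ser.reverse
  simp only [List.append_nil, List.reverse_reverse, List.length_reverse] at h1 h2 h3 h4 h5
  exact (h1.seq (h2.seq (h3.seq (h4.seq h5)))).mono (by simp only [Bin.size]; omega)

/-- The first tree waits on `aux₂` in proper order while the second is read into `aux₁`. It is then
poured on top of the second, and emptying `aux₁` reverses the whole, which exchanges the trees. -/
theorem runs_swap (m : List Bool) (s t : Bin) :
    swap.Runs (𝔸 := 𝔸) (sm (s.ser ++ (t.ser ++ m))) (sm (t.ser ++ (s.ser ++ m)))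
      (8 * s.size + 8 * t.size + 8) := by
  have h1 := runs_grab (𝔸 := 𝔸) [] [] (t.ser ++ m) [] [] s
  have h2 := runs_pour₁₂ (𝔸 := 𝔸) [] [] (t.ser ++ m) s.ser.reverse [] []
  have h3 := runs_grab (𝔸 := 𝔸) [] [] m [] s.ser t
  have h4 := runs_pour₂₁ (𝔸 := 𝔸) [] [] m t.ser.reverse s.ser []
  have h5 := runs_pour₁ (𝔸 := 𝔸) [] [] m (s.ser.reverse ++ t.ser.reverse) [] []
  simp only [List.append_nil, List.reverse_reverse, List.length_reverse, List.reverse_append,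
    List.length_append, List.append_assoc] at h1 h2 h3 h4 h5
  exact (h1.seq (h2.seq (h3.seq (h4.seq h5)))).mono (by simp only [Bin.size]; omega)

theorem runs_drop (m : List Bool) (t : Bin) :
    drop.Runs (𝔸 := 𝔸) (sm (t.ser ++ m)) (sm m) (4 * t.size + 3) := by
  have h1 := runs_grab (𝔸 := 𝔸) [] [] m [] [] t
  have h2 := runs_clear (𝔸 := 𝔸) [] [] m t.ser.reverse [] []
  simp only [List.append_nil, List.length_reverse] at h1 h2
  exact (h1.seq h2).mono (by simp only [Bin.size]; omega)

/-- Push a list of symbols that has length at most `n` and is determined by the internal state. -/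
def pushAll {L : Type} (q : 𝔸.Stm L) : ℕ → (𝔸.State → List Bool) → 𝔸.Stm L
  | 0, _ => q
  | n + 1, f => branch (fun v => (f v).isEmpty) q
      (push (.inl .main) (fun v => (f v).headI) (pushAll q n fun v => (f v).tail))

/-- A statement has a fixed number of pushes, hence the bound `n`, and is executed in one step of
the machine. Pushing reverses the list, so the callers pass reversed lists. -/
theorem stepAux_pushAll {L : Type} (q : 𝔸.Stm L) (v : 𝔸.State) (n : ℕ)
    (f : 𝔸.State → List Bool) (hf : (f v).length ≤ n) (i : List 𝔸.A) (o m a b c : List Bool) :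
    TM2.stepAux (pushAll q n f) v (st i o m a b c) =
      TM2.stepAux q v (st i o ((f v).reverse ++ m) a b c) := by
  induction n generalizing f m with
  | zero => simp [pushAll, List.length_eq_zero_iff.1 (Nat.le_zero.1 hf)]
  | succ n ih =>
    rcases hfv : f v with _ | ⟨x, l⟩
    · simp [pushAll, hfv]
    · rw [pushAll, TM2.stepAux, hfv]
      simp only [List.isEmpty_cons, cond_false, TM2.stepAux, hfv, List.headI, stAll_main,
        update_main]
      rw [ih _ (by simpa [hfv] using hf)]
      simp [hfv]

/-- Push a list of symbols. -/
def pushList (l : List Bool) : Frag 𝔸 :=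
  single fun e => pushAll (goto fun _ => e) l.length fun _ => l.reverse

theorem runs_pushList (l m : List Bool) :
    (pushList l).Runs (𝔸 := 𝔸) (sm m) (sm (l ++ m)) 1 :=
  runs_single fun L e => by rw [stepAux_pushAll _ _ _ _ (by simp)]; simp

/-- Pop a symbol. -/
def popTop : Frag 𝔸 := single fun e => pop (.inl .main) (fun v _ => v) (goto fun _ => e)

theorem runs_popTop (x : Bool) (m : List Bool) :
    popTop.Runs (𝔸 := 𝔸) (sm (x :: m)) (sm m) 1 := runs_single fun L e => by simp

/-- Run `c` or `d` according to whether the top tree is a leaf, which is removed, or not. -/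
def ifLeaf (c d : Frag 𝔸) : Frag 𝔸 :=
  ite (fun e f => pop (.inl .main) (fun v b => reg v b) (branch (fun v => v.1.getD false)
    (push (.inl .main) (fun _ => true) (load (fun v => reg v none) (goto fun _ => f)))
    (load (fun v => reg v none) (goto fun _ => e)))) c d

theorem Runs.ifLeaf_leaf {c d : Frag 𝔸} {m : List Bool} {S' : 𝔸.Store} {n : ℕ}
    (h : c.Runs (sm m) S' n) : (ifLeaf c d).Runs (sm (Bin.leaf.ser ++ m)) S' (1 + n) :=
  Runs.ite_left (fun L e f => by simp [v₀, Bin.ser]) h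

theorem Runs.ifLeaf_node {c d : Frag 𝔸} {m : List Bool} {S' : 𝔸.Store} {n : ℕ} {l r : Bin}
    (h : d.Runs (sm ((Bin.node l r).ser ++ m)) S' n) :
    (ifLeaf c d).Runs (sm ((Bin.node l r).ser ++ m)) S' (1 + n) :=
  Runs.ite_right (fun L e f => by simp [v₀, Bin.ser]) h

/-- Given a tree `n` on top of a tree `x`, apply `c` to `x` as many times as the length of the
rightmost branch of `n`. -/
def iter (c : Frag 𝔸) : Frag 𝔸 :=
  loop (fun e f => pop (.inl .main) (fun v b => reg v b) (branch (fun v => v.1.getD false)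
    (load (fun v => reg v none) (goto fun _ => e))
    (load (fun v => reg v none) (goto fun _ => f)))) (drop.seq (swap.seq (c.seq swap)))

/-- The counter is unwound along its right branch: removing the node bit and the left subtree leaves
the right subtree as the new counter. The two swaps give `c` access to the value below and restore
the order. -/
theorem runs_iter {c : Frag 𝔸} (m : List Bool) (x : ℕ → Bin) (N s : ℕ) (n : Bin)
    (hs : ∀ k ≤ n.spine, (x k).size ≤ s)
    (hc : ∀ k < n.spine, ∀ m, c.Runs (sm ((x k).ser ++ m)) (sm ((x (k + 1)).ser ++ m)) N) :
    (iter c).Runs (sm (n.ser ++ ((x 0).ser ++ m))) (sm ((x n.spine).ser ++ m))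
      (n.size * (N + 20 * n.size + 20 * s + 20)) := by
  -- The cost of a pass is expressed by a fixed `M`, so that it stays the same while the counter
  -- shrinks in the induction.
  suffices H : ∀ M, n.size ≤ M → (iter c).Runs (sm (n.ser ++ ((x 0).ser ++ m)))
      (sm ((x n.spine).ser ++ m)) (n.size * (N + 20 * M + 20 * s + 20)) from H _ le_rfl
  intro M
  induction n generalizing x with
  | leaf =>
    intro hM
    refine Runs.mono (runs_loop_exit fun L e f => ?_) (m := 1) (by simp)
    simp [v₀, Bin.ser, Bin.spine]
  | node l r _ ih =>
    intro hM
    simp only [Bin.size_node] at hM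
    simp only [Bin.spine] at hs hc
    have h1 := runs_drop (𝔸 := 𝔸) (r.ser ++ ((x 0).ser ++ m)) l
    have h2 := runs_swap (𝔸 := 𝔸) m r (x 0)
    have h3 := hc 0 (by omega) (r.ser ++ m)
    have h4 := runs_swap (𝔸 := 𝔸) m (x 1) r
    have h5 := ih (fun k => x (k + 1)) (fun k hk => hs _ (by omega))
      (fun k hk => hc _ (by omega)) (by omega)
    refine (Runs.loop_step (S₁ := sm (l.ser ++ (r.ser ++ ((x 0).ser ++ m)))) ?_
      (h1.seq (h2.seq (h3.seq h4))) h5).mono ?_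
    · intros; simp [v₀, Bin.ser]
    · have e0 := hs 0 (by omega)
      have e1 := hs 1 (by omega)
      simp only [Bin.size_node]
      have : (l.size + r.size + 1) * (N + 20 * M + 20 * s + 20) =
        r.size * (N + 20 * M + 20 * s + 20) + (N + 20 * M + 20 * s + 20) +
          l.size * (N + 20 * M + 20 * s + 20) := by ring
      rw [this]
      omega

end Frag

end PolyTime

/-! ### Truth values, numbers, pairs and lists as trees -/

namespace PolyTime

open Turing Ambient

variable {𝔸 : Ambient}

open TM2.Stmt

/-- A type whose elements are represented by binary trees. -/
class Enc (α : Type) where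
  /-- the representation of an element -/
  enc : α → Bin

open Enc

/-- The size of the tree that represents an element. -/
def sz {α : Type} [Enc α] (a : α) : ℕ := (enc a).size

/-- The representations are chosen such that a test for a leaf decides between `false` and `true`,
zero and successor, empty and nonempty list. Numbers and lists are right combs, so that the right
branch of the tree measures the value or the length and the tree itself can serve as a loop counter.
-/
instance : Enc Bool where
  enc b := if b then .node .leaf .leaf else .leaf

instance : Enc Unit where
  enc _ := .leaf

instance : Enc ℕ where
  enc n := Nat.rec .leaf (fun _ t => .node .leaf t) n

instance {α β : Type} [Enc α] [Enc β] : Enc (α × β) where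
  enc x := .node (enc x.1) (enc x.2)

instance {α : Type} [Enc α] : Enc (List α) where
  enc l := l.foldr (fun a t => .node (enc a) t) .leaf

section
variable {α β : Type} [Enc α] [Enc β]

theorem enc_true : enc true = .node .leaf .leaf := rfl
theorem enc_false : enc false = .leaf := rfl
theorem enc_zero : enc 0 = .leaf := rfl
theorem enc_succ (n : ℕ) : enc (n + 1) = .node .leaf (enc n) := rfl
theorem enc_prod (a : α) (b : β) : enc (a, b) = .node (enc a) (enc b) := rfl
theorem enc_nil : enc ([] : List α) = .leaf := rfl
theorem enc_cons (a : α) (l : List α) : enc (a :: l) = .node (enc a) (enc l) := rfl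

theorem sz_pos (a : α) : 0 < sz a := Bin.size_pos _

theorem sz_prod (a : α) (b : β) : sz (a, b) = sz a + sz b + 1 := by simp [sz, enc_prod]

theorem sz_nat (n : ℕ) : sz n = 2 * n + 1 := by
  induction n with
  | zero => simp [sz, enc_zero]
  | succ n ih => simp only [sz, enc_succ, Bin.size_node, Bin.size_leaf] at ih ⊢; omega

theorem sz_bool_le (b : Bool) : sz b ≤ 3 := by cases b <;> simp [sz, enc_true, enc_false]

@[simp] theorem sz_nil : sz ([] : List α) = 1 := by simp [sz, enc_nil]

@[simp] theorem sz_cons (a : α) (l : List α) : sz (a :: l) = sz a + sz l + 1 := by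
  simp [sz, enc_cons]

theorem spine_nat (n : ℕ) : (enc n).spine = n := by
  induction n with
  | zero => rfl
  | succ n ih => simp [enc_succ, Bin.spine, ih]

theorem spine_list (l : List α) : (enc l).spine = l.length := by
  induction l with
  | nil => rfl
  | cons a l ih => simp [enc_cons, Bin.spine, ih]

end

namespace Frag

/-! ### Calling a subroutine -/

section Call

variable (i : 𝔸.ι)

/-- A statement of a subroutine as a statement of the calling machine. -/
def liftStm {L : Type} (lab : (𝔸.tm i).Λ → L) (ret : L) :
    TM2.Stmt (𝔸.tm i).Γ (𝔸.tm i).Λ (𝔸.tm i).σ → 𝔸.Stm L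
  | push k f q => push (.inr ⟨i, k⟩) (fun v => f (v.2.2 i)) (liftStm lab ret q)
  | peek k f q => peek (.inr ⟨i, k⟩)
      (fun v o => (v.1, v.2.1, Function.update v.2.2 i (f (v.2.2 i) o))) (liftStm lab ret q)
  | pop k f q => pop (.inr ⟨i, k⟩)
      (fun v o => (v.1, v.2.1, Function.update v.2.2 i (f (v.2.2 i) o))) (liftStm lab ret q)
  | load f q => load (fun v => (v.1, v.2.1, Function.update v.2.2 i (f (v.2.2 i))))
      (liftStm lab ret q)
  | branch f q r => branch (fun v => f (v.2.2 i)) (liftStm lab ret q) (liftStm lab ret r)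
  | goto f => goto fun v => lab (f (v.2.2 i))
  | halt => goto fun _ => ret

/-- The stacks of the subroutines when only those of the subroutine `i` are in use. -/
abbrev only (T : ∀ k, List ((𝔸.tm i).Γ k)) : ∀ j k, List ((𝔸.tm j).Γ k) :=
  Function.update (fun _ _ => []) i T

/-- A configuration of a subroutine as a configuration of the calling machine. -/
def liftCfg {L : Type} (lab : (𝔸.tm i).Λ → L) (ret : L) (m : List Bool) (c : (𝔸.tm i).Cfg) :
    𝔸.Conf L where
  l := some (c.l.elim ret lab)
  var := (none, none, Function.update 𝔸.v₀.2.2 i c.var)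
  stk := stAll [] [] m [] [] [] (only i c.stk)

/-- The translated statement touches only the stacks and the state component of the subroutine `i`.
Since `halt` becomes a jump to `ret`, a halted configuration of the subroutine corresponds to the
calling machine being at `ret`. -/
theorem stepAux_liftStm {L : Type} (lab : (𝔸.tm i).Λ → L) (ret : L) (m : List Bool)
    (q : TM2.Stmt (𝔸.tm i).Γ (𝔸.tm i).Λ (𝔸.tm i).σ) (s : (𝔸.tm i).σ)
    (T : ∀ k, List ((𝔸.tm i).Γ k)) :
    TM2.stepAux (liftStm i lab ret q) (none, none, Function.update 𝔸.v₀.2.2 i s)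
      (stAll [] [] m [] [] [] (only i T)) = liftCfg i lab ret m (TM2.stepAux q s T) := by
  induction q generalizing s T with
  | push k f q ih => simpa [liftStm] using ih _ _
  | peek k f q ih => simpa [liftStm] using ih _ _
  | pop k f q ih => simpa [liftStm] using ih _ _
  | load f q ih => simpa [liftStm] using ih _ _
  | branch f q r ihq ihr =>
    simp only [liftStm, TM2.stepAux, Function.update_self]
    cases f s
    · exact ihr _ _
    · exact ihq _ _
  | goto f => simp [liftStm, liftCfg]
  | halt => simp [liftStm, liftCfg]

theorem reach_liftCfg {L : Type} {M : L → 𝔸.Stm L} (lab : (𝔸.tm i).Λ → L) (ret : L)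
    (m : List Bool) (hM : ∀ l, M (lab l) = liftStm i lab ret ((𝔸.tm i).m l)) (n : ℕ)
    (c d : (𝔸.tm i).Cfg) (h : (flip bind (𝔸.tm i).step)^[n] (some c) = some d) :
    Reach M n (liftCfg i lab ret m c) (liftCfg i lab ret m d) := by
  induction n generalizing c with
  | zero => cases h; exact Reach.refl
  | succ n ih =>
    obtain ⟨l, s, T⟩ := c
    rw [Function.iterate_succ_apply] at h
    cases l with
    | none =>
      -- A halted configuration has no successor, so it cannot reach `d` in a positive number of
      -- steps.
      exfalso
      have : ∀ n, (flip bind (𝔸.tm i).step)^[n] none = none := fun n => by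
        induction n with
        | zero => rfl
        | succ n ih => rw [Function.iterate_succ_apply]; exact ih
      exact absurd ((this n).symm.trans h) (by simp)
    | some l =>
      rw [Nat.add_comm]
      refine Reach.trans (Reach.one ?_) (ih _ h)
      change some (TM2.stepAux (M (lab l)) _ _) = some (liftCfg i lab ret m _)
      rw [hM, ← stepAux_liftStm]

/-- Run a subroutine. -/
def exec : Frag 𝔸 where
  Λ := (𝔸.tm i).Λ
  entry := (𝔸.tm i).main
  code lab exit l := liftStm i lab exit ((𝔸.tm i).m l)

/-- Stack contents of a subroutine with only one nonempty stack. -/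
abbrev onStack (k : (𝔸.tm i).K) (l : List ((𝔸.tm i).Γ k)) : ∀ k, List ((𝔸.tm i).Γ k) :=
  Function.update (fun _ => []) k l

theorem initList_stk (l : List ((𝔸.tm i).Γ (𝔸.tm i).k₀)) :
    (initList (𝔸.tm i) l).stk = onStack i (𝔸.tm i).k₀ l := by
  funext k
  by_cases h : k = (𝔸.tm i).k₀
  · subst h; simp [initList]
  · simp [initList, h]

theorem haltList_stk (l : List ((𝔸.tm i).Γ (𝔸.tm i).k₁)) :
    (haltList (𝔸.tm i) l).stk = onStack i (𝔸.tm i).k₁ l := by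
  funext k
  by_cases h : k = (𝔸.tm i).k₁
  · subst h; simp [haltList]
  · simp [haltList, h]

/-- A halting configuration `haltList` has the initial internal state and empty stacks apart from
the output stack. Hence the state `𝔸.v₀` is restored, and the subroutine can be called again once
its answer is removed. -/
theorem runs_exec (n : ℕ) (m : List Bool) :
    (exec i).Runs
      (stAll [] [] m [] [] [] (only i (onStack i (𝔸.tm i).k₀
        ((Computability.unaryEncodingNat.encode n).map (𝔸.comp i).inputAlphabet.symm))))
      (stAll [] [] m [] [] [] (only i (onStack i (𝔸.tm i).k₁
        [(𝔸.comp i).outputAlphabet.symm (𝔸.f i n)])))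
      ((𝔸.comp i).time.eval n) := by
  intro L M emb exit hM
  have h := (𝔸.comp i).outputsFun n
  have hlen : (Computability.unaryEncodingNat.encode n).length = n :=
    Computability.unary_decode_encode_nat n
  have e := reach_liftCfg i emb exit m hM _ _ _ h.evals_in_steps
  convert e.mono (h.steps_le_m.trans (by rw [hlen])) using 1
  · exact congrArg₂ (TM2.Cfg.mk _) (by simp [v₀, initList])
      (congrArg (fun T => stAll [] [] m [] [] [] (only i T)) (initList_stk i _).symm)
  · exact congrArg₂ (TM2.Cfg.mk _) (by simp [v₀, haltList])
      (congrArg (fun T => stAll [] [] m [] [] [] (only i T)) (haltList_stk i _).symm)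

/-- Move a number from the main stack to the input stack of a subroutine. -/
def feed : Frag 𝔸 :=
  loop (fun e f => pop (.inl .main) (fun v b => reg v b) (branch (fun v => v.1.getD false)
    -- A successor starts with two symbols, the node bit and the code of its left leaf; the second
    -- one is removed here.
    (pop (.inl .main) (fun v _ => reg v none)
      (push (.inr ⟨i, (𝔸.tm i).k₀⟩) (fun _ => (𝔸.comp i).inputAlphabet.symm true)
        (goto fun _ => e)))
    (load (fun v => reg v none) (goto fun _ => f)))) skip

theorem runs_feed (n : ℕ) (m : List Bool) (l : List ((𝔸.tm i).Γ (𝔸.tm i).k₀)) :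
    (feed i).Runs
      (stAll [] [] ((enc n).ser ++ m) [] [] [] (only i (onStack i (𝔸.tm i).k₀ l)))
      (stAll [] [] m [] [] [] (only i (onStack i (𝔸.tm i).k₀
        ((Computability.unaryEncodingNat.encode n).map (𝔸.comp i).inputAlphabet.symm ++ l))))
      (2 * n + 1) := by
  induction n generalizing l with
  | zero => 
    refine runs_loop_exit fun L e f => ?_
    simp [v₀, enc_zero, Bin.ser, Computability.unaryEncodingNat, Computability.unaryEncodeNat]
  | succ n ih =>
    have h := ih ((𝔸.comp i).inputAlphabet.symm true :: l)
    have e : ∀ n, (Computability.unaryEncodingNat.encode n) = List.replicate n true := fun n => by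
      induction n with
      | zero => rfl
      | succ n ih => rw [List.replicate_succ, ← ih]; rfl
    rw [e, List.map_replicate] at h ⊢
    rw [List.replicate_succ', List.append_assoc]
    refine (Runs.loop_step (fun L e f => ?_) (runs_skip _) h).mono (by omega)
    simp [v₀, enc_succ, Bin.ser]

/-- Move the answer of a subroutine to the main stack. -/
def answer : Frag 𝔸 :=
  single fun e => pop (.inr ⟨i, (𝔸.tm i).k₁⟩)
    (fun v o => reg v (o.map (𝔸.comp i).outputAlphabet))
    -- The longest code of a truth value is that of `true`, with three symbols.
    (pushAll (load (fun v => reg v none) (goto fun _ => e)) 3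
      fun v => (enc (v.1.getD false)).ser.reverse)

theorem runs_answer (b : Bool) (m : List Bool) :
    (answer i).Runs (stAll [] [] m [] [] []
      (only i (onStack i (𝔸.tm i).k₁ [(𝔸.comp i).outputAlphabet.symm b])))
      (sm ((enc b).ser ++ m)) 1 := by
  refine runs_single fun L e => ?_
  rw [TM2.stepAux]
  have : only i (onStack i (𝔸.tm i).k₁ []) = fun _ _ => [] := by simp [only, onStack]
  simp only [stAll_inr, update_inr, Function.update_self, List.tail, Function.update_idem, this]
  rw [stepAux_pushAll]
  · simp [v₀]
  · cases b <;> simp [enc_true, enc_false, Bin.ser]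

/-- Replace the number on the main stack by the answer of a subroutine. -/
def call : Frag 𝔸 := (feed i).seq ((exec i).seq (answer i))

theorem runs_call (n : ℕ) (m : List Bool) :
    (call i).Runs (sm ((enc n).ser ++ m)) (sm ((enc (𝔸.f i n)).ser ++ m))
      (2 * n + 2 + (𝔸.comp i).time.eval n) := by
  have h' := runs_feed i n m []
  rw [List.append_nil] at h'
  have h := h'.seq ((runs_exec i n m).seq (runs_answer i (𝔸.f i n) m))
  have : only i (onStack i (𝔸.tm i).k₀ []) = fun _ _ => [] := by simp [only, onStack]
  rw [this] at h
  exact h.mono (by omega)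

end Call

/-! ### Reading the input and writing the output -/

/-- Move the input to the main stack, in reverse order. -/
def read [Enc 𝔸.A] : Frag 𝔸 :=
  (pushList [false]).seq
    (loop (fun e f => pop (.inl .inp) (fun v x => (v.1, x, v.2.2))
      (branch (fun v => v.2.1.isSome)
        (pushAll (load (fun v => (v.1, none, v.2.2)) (goto fun _ => e))
          -- The alphabet is finite, so the codes of its symbols have bounded length; one more
          -- symbol is needed for the node bit of the list cell.
          (Finset.univ.sup (fun x : 𝔸.A => sz x) + 1)
          fun v => (v.2.1.elim [] fun x => true :: (enc x).ser).reverse)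
        (goto fun _ => f))) skip)

theorem runs_read [Enc 𝔸.A] (l : List 𝔸.A) :
    read.Runs (st l [] [] [] [] []) (sm (𝔸 := 𝔸) (enc l.reverse).ser) (2 * l.length + 2) := by
  refine Runs.mono (Runs.seq (S' := st l [] [false] [] [] []) (m := 1) (n := 2 * l.length + 1)
    (runs_single fun L e => by rw [stepAux_pushAll _ _ _ _ (by simp)]; simp) ?_) (by omega)
  suffices H : ∀ r : List 𝔸.A, Runs _ (st l [] (enc r).ser [] [] [])
      (st [] [] (enc (l.reverse ++ r)).ser [] [] []) (2 * l.length + 1) by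
    simpa [enc_nil, Bin.ser] using H []
  induction l with
  | nil => exact fun r => runs_loop_exit fun L e f => by simp [v₀]
  | cons x l ih =>
    intro r
    have h := ih (x :: r)
    refine (Runs.loop_step (fun L e f => ?_) (runs_skip _)
      (by simpa using h)).mono (by simp; omega)
    simp only [TM2.stepAux, stAll_inp, List.head?_cons, List.tail_cons, update_inp,
      Option.isSome_some, cond_true]
    rw [stepAux_pushAll]
    · simp [v₀, enc_cons, Bin.ser]
    · simpa [sz, Bin.size] using Finset.le_sup (f := fun x : 𝔸.A => sz x) (Finset.mem_univ x)

/-- Move a truth value from the main stack to the output and halt. -/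
def write {L : Type} : 𝔸.Stm L :=
  pop (.inl .main) (fun v b => reg v b) (branch (fun v => v.1.getD false)
    (pop (.inl .main) (fun v _ => v) (pop (.inl .main) (fun v _ => v)
      (push (.inl .out) (fun v => v.1.getD false) (load (fun v => reg v none) halt))))
    (push (.inl .out) (fun v => v.1.getD false) (load (fun v => reg v none) halt)))

theorem stepAux_write {L : Type} (b : Bool) :
    TM2.stepAux (write (L := L)) 𝔸.v₀ (sm (enc b).ser) = ⟨none, 𝔸.v₀, st [] [b] [] [] [] []⟩ := by
  cases b <;> simp [write, v₀, enc_true, enc_false, Bin.ser]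

variable (𝔸) in
/-- The machine that reads its input, runs a fragment and writes the output. -/
def machine [Enc 𝔸.A] (c : Frag 𝔸) : FinTM2 where
  K := 𝔸.K
  k₀ := .inl .inp
  k₁ := .inl .out
  Γ := 𝔸.Γ
  Γk₀Fin := 𝔸.fintypeA
  Λ := Option (read (𝔸 := 𝔸).seq c).Λ
  main := some (read.seq c).entry
  σ := 𝔸.State
  initialState := 𝔸.v₀
  m
    | none => write
    | some l => (read.seq c).code some none l

theorem machine_outputs [Enc 𝔸.A] (c : Frag 𝔸) (l : List 𝔸.A) (b : Bool) (n : ℕ)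
    (h : c.Runs (sm (enc l.reverse).ser) (sm (enc b).ser) n) :
    Nonempty (TM2OutputsInTime (machine 𝔸 c) l (some [b]) (2 * l.length + 2 + n + 1)) := by
  have hi : initList (machine 𝔸 c) l =
      ⟨some (some (read (𝔸 := 𝔸).seq c).entry), 𝔸.v₀, st l [] [] [] [] []⟩ := by
    refine congrArg (TM2.Cfg.mk _ _) (funext fun k => ?_)
    rcases k with (_ | _) | _ <;> rfl
  have ho : haltList (machine 𝔸 c) [b] = ⟨none, 𝔸.v₀, st [] [b] [] [] [] []⟩ := by
    refine congrArg (TM2.Cfg.mk _ _) (funext fun k => ?_)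
    rcases k with (_ | _) | _ <;> rfl
  obtain ⟨k, hk, e⟩ := (((runs_read l).seq h) _ (machine 𝔸 c).m some none fun _ => rfl).trans
    (Reach.one (congrArg some (stepAux_write b)))
  refine ⟨⟨⟨k, ?_⟩, hk⟩⟩
  rw [hi]
  change _ = some (haltList (machine 𝔸 c) [b])
  rw [ho]
  exact e

end Frag

end PolyTime

namespace PolyTime

open Turing Ambient Enc Frag

/-! ### Polynomial bounds -/

theorem eval_mono (p : Polynomial ℕ) {m n : ℕ} (h : m ≤ n) : p.eval m ≤ p.eval n := by
  simp only [Polynomial.eval_eq_sum, Polynomial.sum]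
  gcongr

/-- The function `s` is bounded by a polynomial in the size of its argument. -/
def PolyBounded {α : Type} [Enc α] (s : α → ℕ) : Prop := ∃ p : Polynomial ℕ, ∀ a, s a ≤ p.eval (sz a)

namespace PolyBounded

variable {α β : Type} [Enc α] [Enc β] {s t : α → ℕ}

theorem mono (h : PolyBounded t) (hst : ∀ a, s a ≤ t a) : PolyBounded s :=
  let ⟨p, hp⟩ := h; ⟨p, fun a => (hst a).trans (hp a)⟩

theorem const (n : ℕ) : PolyBounded fun _ : α => n := ⟨.C n, fun _ => by simp⟩

theorem size : PolyBounded fun a : α => sz a := ⟨.X, fun _ => by simp⟩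

theorem add (hs : PolyBounded s) (ht : PolyBounded t) : PolyBounded fun a => s a + t a :=
  let ⟨p, hp⟩ := hs; let ⟨q, hq⟩ := ht
  ⟨p + q, fun a => by simpa using add_le_add (hp a) (hq a)⟩

theorem mul (hs : PolyBounded s) (ht : PolyBounded t) : PolyBounded fun a => s a * t a :=
  let ⟨p, hp⟩ := hs; let ⟨q, hq⟩ := ht
  ⟨p * q, fun a => by simpa using Nat.mul_le_mul (hp a) (hq a)⟩

theorem eval (p : Polynomial ℕ) (hs : PolyBounded s) : PolyBounded fun a => p.eval (s a) :=
  let ⟨q, hq⟩ := hs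
  ⟨p.comp q, fun a => by simpa using eval_mono p (hq a)⟩

theorem comp {s : β → ℕ} {f : α → β} (hs : PolyBounded s) (hf : PolyBounded fun a => sz (f a)) :
    PolyBounded fun a => s (f a) :=
  let ⟨p, hp⟩ := hs; (hf.eval p).mono fun a => hp (f a)

end PolyBounded

/-! ### Functions that are computable in polynomial time -/

/-- The function `f` is computable in polynomial time by a fragment that replaces the argument on
top of the main stack by the value. -/
@[fun_prop]
def PolyFun (𝔸 : Ambient) {α β : Type} [Enc α] [Enc β] (f : α → β) : Prop :=
  (PolyBounded fun a => sz (f a)) ∧ ∃ c : Frag 𝔸, ∃ t : α → ℕ, PolyBounded t ∧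
    ∀ a m, c.Runs (sm ((enc a).ser ++ m)) (sm ((enc (f a)).ser ++ m)) (t a)

variable {𝔸 : Ambient}

namespace PolyFun

variable {α β γ δ ε : Type} [Enc α] [Enc β] [Enc γ] [Enc δ] [Enc ε]

theorem bounded {f : α → β} (hf : PolyFun 𝔸 f) : PolyBounded fun a => sz (f a) := hf.1

/-- Functions that do not change the representation. -/
theorem of_enc_eq {f : α → β} (h : ∀ a, enc (f a) = enc a) : PolyFun 𝔸 f :=
  ⟨PolyBounded.size.mono fun a => by simp [sz, h], skip, fun _ => 1, .const 1, fun a m => by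
    rw [h]; exact runs_skip _⟩

@[fun_prop]
theorem id : PolyFun 𝔸 fun a : α => a := of_enc_eq fun _ => rfl

@[fun_prop]
theorem comp {f : β → γ} {g : α → β} (hf : PolyFun 𝔸 f) (hg : PolyFun 𝔸 g) :
    PolyFun 𝔸 fun a => f (g a) := by
  obtain ⟨bf, c, t, ht, hc⟩ := hf
  obtain ⟨bg, d, u, hu, hd⟩ := hg
  exact ⟨bf.comp bg, d.seq c, _, hu.add (ht.comp bg), fun a m => (hd a m).seq (hc (g a) m)⟩

@[fun_prop]
theorem const (b : β) : PolyFun 𝔸 fun _ : α => b :=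
  ⟨.const _, drop.seq (pushList (enc b).ser), _,
    ((PolyBounded.const 4).mul .size).add (.const 4), fun a m =>
      ((runs_drop m (enc a)).seq (runs_pushList _ _)).mono (by simp [sz])⟩

@[fun_prop]
theorem pair {f : α → β} {g : α → γ} (hf : PolyFun 𝔸 f) (hg : PolyFun 𝔸 g) :
    PolyFun 𝔸 fun a => (f a, g a) := by
  obtain ⟨bf, c, t, ht, hc⟩ := hf
  obtain ⟨bg, d, u, hu, hd⟩ := hg
  refine ⟨((bf.add bg).add (.const 1)).mono fun a => (sz_prod _ _).le,
    -- The value of `g` is computed first, because the code of a pair has its first component on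
    -- top.
    dup.seq (d.seq (swap.seq (c.seq (pushList [true])))), _,
    ((((PolyBounded.const 18).mul .size).add (.const 15)).add (hu.add ht)).add
      ((PolyBounded.const 8).mul bg), fun a m => ?_⟩
  have h1 := runs_dup (𝔸 := 𝔸) m (enc a)
  have h2 := hd a ((enc a).ser ++ m)
  have h3 := runs_swap (𝔸 := 𝔸) m (enc (g a)) (enc a)
  have h4 := hc a ((enc (g a)).ser ++ m)
  have h5 := runs_pushList (𝔸 := 𝔸) [true] ((enc (f a)).ser ++ ((enc (g a)).ser ++ m))
  have := h1.seq (h2.seq (h3.seq (h4.seq h5)))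
  simp only [List.cons_append, List.nil_append] at this
  rw [enc_prod, Bin.ser, List.cons_append, List.append_assoc]
  exact this.mono (by simp only [sz]; omega)

@[fun_prop]
theorem fst {f : α → β × γ} (hf : PolyFun 𝔸 f) : PolyFun 𝔸 fun a => (f a).1 := by
  refine comp (f := Prod.fst) ?_ hf
  refine ⟨PolyBounded.size.mono fun x => by rw [sz_prod]; omega, popTop.seq (swap.seq drop), _,
    ((PolyBounded.const 12).mul .size).add (.const 12), fun x m => ?_⟩
  have h1 := runs_popTop (𝔸 := 𝔸) true ((enc x.1).ser ++ ((enc x.2).ser ++ m))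
  have h2 := runs_swap (𝔸 := 𝔸) m (enc x.1) (enc x.2)
  have h3 := runs_drop (𝔸 := 𝔸) ((enc x.1).ser ++ m) (enc x.2)
  rw [enc_prod, Bin.ser, List.cons_append, List.append_assoc]
  refine (h1.seq (h2.seq h3)).mono ?_
  have : sz x = (enc x.1).size + (enc x.2).size + 1 := sz_prod x.1 x.2
  omega

@[fun_prop]
theorem snd {f : α → β × γ} (hf : PolyFun 𝔸 f) : PolyFun 𝔸 fun a => (f a).2 := by
  refine comp (f := Prod.snd) ?_ hf
  refine ⟨PolyBounded.size.mono fun x => by rw [sz_prod]; omega, popTop.seq drop, _,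
    ((PolyBounded.const 4).mul .size).add (.const 4), fun x m => ?_⟩
  have h1 := runs_popTop (𝔸 := 𝔸) true ((enc x.1).ser ++ ((enc x.2).ser ++ m))
  have h3 := runs_drop (𝔸 := 𝔸) ((enc x.2).ser ++ m) (enc x.1)
  rw [enc_prod, Bin.ser, List.cons_append, List.append_assoc]
  refine (h1.seq h3).mono ?_
  have : sz x = (enc x.1).size + (enc x.2).size + 1 := sz_prod x.1 x.2
  omega

/-- Distinction of cases according to whether the value of `d` is represented by a leaf. -/
theorem cases {d : α → δ} {g : α → γ} {h : α × ε → γ} {r : α → γ} (hd : PolyFun 𝔸 d)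
    (hg : PolyFun 𝔸 g) (hh : PolyFun 𝔸 h)
    (H : ∀ a, (enc (d a) = .leaf ∧ r a = g a) ∨
      ∃ e s t, enc (d a) = .node s t ∧ enc e = .node s t ∧ r a = h (a, e)) : PolyFun 𝔸 r := by
  -- If `d a` is not a leaf, its tree is reread as an element `e` of another type with the same
  -- tree: a nonempty list becomes its head and tail, a successor a pair in `Unit × ℕ`.
  obtain ⟨bd, c, t, ht, hc⟩ := pair id hd
  obtain ⟨bg, c₁, t₁, ht₁, hc₁⟩ := hg
  obtain ⟨⟨q, hq⟩, c₂, t₂, ⟨p, hp⟩, hc₂⟩ := hh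
  refine ⟨(bg.add (bd.eval q)).mono fun a => ?_,
    c.seq (popTop.seq (swap.seq (ifLeaf c₁ (swap.seq ((pushList [true]).seq c₂))))), _,
    ((ht.add (ht₁.add (bd.eval p))).add ((PolyBounded.const 16).mul bd)).add (.const 20),
    fun a m => ?_⟩
  · rcases H a with ⟨-, e⟩ | ⟨x, l, r, e, ex, hr⟩
    · rw [e]; exact Nat.le_add_right _ _
    · rw [hr]
      refine (hq _).trans ?_
      have : sz (a, x) = sz (a, d a) := by simp only [sz_prod]; simp only [sz, e, ex]
      rw [this]; exact Nat.le_add_left _ _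
  · have h0 := hc a m
    have h1 := runs_popTop (𝔸 := 𝔸) true ((enc a).ser ++ ((enc (d a)).ser ++ m))
    have h2 := runs_swap (𝔸 := 𝔸) m (enc a) (enc (d a))
    rw [enc_prod, Bin.ser, List.cons_append, List.append_assoc] at h0
    have hs : sz (a, d a) = (enc a).size + (enc (d a)).size + 1 := sz_prod _ _
    rcases H a with ⟨e, hr⟩ | ⟨x, l, r, e, ex, hr⟩
    · have h3 := (hc₁ a m).ifLeaf_leaf (d := swap.seq ((pushList [true]).seq c₂))
      rw [← e] at h3
      rw [hr]
      exact (h0.seq (h1.seq (h2.seq h3))).mono (by beta_reduce; omega)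
    · have h3 := runs_swap (𝔸 := 𝔸) m (enc (d a)) (enc a)
      have h4 := runs_pushList (𝔸 := 𝔸) [true] ((enc a).ser ++ ((enc (d a)).ser ++ m))
      have h5 := hc₂ (a, x) m
      rw [enc_prod, ex, ← e, Bin.ser, List.cons_append, List.append_assoc, ← hr] at h5
      have h6 := h3.seq (h4.seq h5)
      rw [e] at h6
      have h7 := h6.ifLeaf_node (c := c₁)
      rw [← e] at h7
      have : sz (a, x) = sz (a, d a) := by simp only [sz_prod]; simp only [sz, e, ex]
      have h8 := hp (a, x)
      rw [this] at h8
      exact (h0.seq (h1.seq (h2.seq h7))).mono (by beta_reduce; omega)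

/-- Iteration, as many times as the length of the rightmost branch of a counter. -/
theorem iterate {n : α → δ} {g : α → β} {f : β → β} (hn : PolyFun 𝔸 n) (hg : PolyFun 𝔸 g)
    (hf : PolyFun 𝔸 f) {s : α → ℕ} (hs : PolyBounded s)
    (hb : ∀ a, ∀ k ≤ (enc (n a)).spine, sz (f^[k] (g a)) ≤ s a) :
    PolyFun 𝔸 fun a => f^[(enc (n a)).spine] (g a) := by
  obtain ⟨bn, c, t, ht, hc⟩ := pair hn hg
  obtain ⟨-, d, u, ⟨p, hp⟩, hd⟩ := hf
  have b := hn.bounded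
  refine ⟨hs.mono fun a => hb a _ le_rfl, c.seq (popTop.seq (iter d)), _,
    (ht.add (.const 1)).add (b.mul ((((hs.eval p).add ((PolyBounded.const 20).mul b)).add
      ((PolyBounded.const 20).mul hs)).add (.const 20))), fun a m => ?_⟩
  have h0 := hc a m
  have h1 := runs_popTop (𝔸 := 𝔸) true ((enc (n a)).ser ++ ((enc (g a)).ser ++ m))
  -- All intermediate values have size at most `s a`, so one polynomial bounds the cost of every
  -- pass. Without `hb`, growth by a constant factor in each pass would already be exponential.
  have h2 := runs_iter (𝔸 := 𝔸) (c := d) m (fun k => enc (f^[k] (g a))) (p.eval (s a)) (s a)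
    (enc (n a)) (hb a) fun k hk m => by
      simp only [Function.iterate_succ_apply']
      exact (hd _ m).mono ((hp _).trans (eval_mono _ (hb a k hk.le)))
  rw [enc_prod, Bin.ser, List.cons_append, List.append_assoc] at h0
  exact (h0.seq (h1.seq h2)).mono (by simp only [sz]; omega)

/-- The functions computed by the subroutines. -/
theorem call (i : 𝔸.ι) : PolyFun 𝔸 (𝔸.f i) := by
  refine ⟨(PolyBounded.const 3).mono fun n => sz_bool_le _, Frag.call i, _,
    ((PolyBounded.const 1).mul .size |>.add (.const 1)).add
      ((PolyBounded.eval (𝔸.comp i).time (.size))), fun n m => (runs_call i n m).mono ?_⟩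
  have := sz_nat n
  have h := eval_mono (𝔸.comp i).time (show n ≤ sz n by omega)
  omega

end PolyFun

/-- The reversal is there because `read` delivers the input in reverse order. As the alphabet is
finite, the tree of a string has size linear in the length of the string, so bounds in terms of `sz`
become polynomials in the input length. -/
theorem PolyFun.tm2 [Enc 𝔸.A] {f : List 𝔸.A → Bool} (hf : PolyFun 𝔸 fun l : List 𝔸.A => f l.reverse) {α : Type}
    (ea : α → List 𝔸.A) :
    Nonempty (TM2ComputableInPolyTime ea Computability.encodeBool fun a => f (ea a)) := by
  obtain ⟨-, c, t, ⟨p, hp⟩, hc⟩ := hf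
  have hsz (l : List 𝔸.A) :
      sz l ≤ (Finset.univ.sup (fun x : 𝔸.A => sz x) + 1) * l.length + 1 := by
    induction l with
    | nil => simp
    | cons x l ih =>
      have := Finset.le_sup (f := fun x : 𝔸.A => sz x) (Finset.mem_univ x)
      simp only [sz_cons, List.length_cons, Nat.mul_add]
      omega
  have key (l : List 𝔸.A) := machine_outputs c l (f l) (t l.reverse) (by
    simpa using hc l.reverse [])
  refine ⟨⟨⟨machine 𝔸 c, Equiv.refl _, Equiv.refl _⟩, 2 * .X + 3 +
    p.comp (.C (Finset.univ.sup (fun x : 𝔸.A => sz x) + 1) * .X + 1), fun a => ?_⟩⟩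
  refine ⟨⟨(key (ea a)).some.steps, ?_⟩, (key (ea a)).some.steps_le_m.trans ?_⟩
  · exact (congrArg (fun x : List 𝔸.A => (flip bind (machine 𝔸 c).step)^[(key (ea a)).some.steps]
      (some (initList (machine 𝔸 c) x))) (List.map_id (ea a))).trans
        (key (ea a)).some.evals_in_steps
  · have h1 := (hp (ea a).reverse).trans (eval_mono p (hsz _))
    simp at h1 ⊢
    omega

end PolyTime

/-! ### Arithmetic, list operations and predicates in polynomial time -/

namespace PolyTime

open Enc

section

variable {α β : Type} [Enc α] [Enc β]

theorem sz_append (l l' : List α) : sz (l ++ l') + 1 = sz l + sz l' := by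
  induction l with
  | nil => simp; omega
  | cons a l ih => simp; omega

theorem sz_reverse (l : List α) : sz l.reverse = sz l := by
  induction l with
  | nil => rfl
  | cons a l ih => have := sz_append l.reverse [a]; simp at this ⊢; omega

theorem sz_take_le (l : List α) (k : ℕ) : sz (l.take k) ≤ sz l := by
  have := sz_append (l.take k) (l.drop k)
  have := sz_pos (l.drop k)
  rw [List.take_append_drop] at *
  omega

theorem sz_drop_le (l : List α) (k : ℕ) : sz (l.drop k) ≤ sz l := by
  have := sz_append (l.take k) (l.drop k)
  have := sz_pos (l.take k)
  rw [List.take_append_drop] at *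
  omega

theorem sz_le_of_suffix {l l' : List α} (h : l' <:+ l) : sz l' ≤ sz l := by
  obtain ⟨t, rfl⟩ := h
  have := sz_append t l'
  have := sz_pos t
  omega

theorem length_lt_sz (l : List α) : l.length < sz l := by
  induction l with
  | nil => simp
  | cons a l ih => simp; omega

theorem sz_lt_of_mem {l : List α} {a : α} (h : a ∈ l) : sz a < sz l := by
  induction l with
  | nil => simp at h
  | cons b l ih =>
    rcases List.mem_cons.1 h with rfl | h
    · simp
    · have := ih h; simp; omega

theorem sz_list_le (l : List α) (s : ℕ) (h : ∀ a ∈ l, sz a ≤ s) :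
    sz l ≤ l.length * (s + 1) + 1 := by
  induction l with
  | nil => simp
  | cons a l ih =>
    have h1 := ih fun b hb => h b (List.mem_cons_of_mem _ hb)
    have h2 := h a (by simp)
    simp only [sz_cons, List.length_cons, Nat.add_mul]
    omega

end

variable {𝔸 : Ambient}

namespace PolyFun

variable {α β γ δ : Type} [Enc α] [Enc β] [Enc γ] [Enc δ]

@[fun_prop]
theorem cond {c : α → Bool} {f g : α → β} (hc : PolyFun 𝔸 c) (hf : PolyFun 𝔸 f) (hg : PolyFun 𝔸 g) :
    PolyFun 𝔸 fun a => bif c a then f a else g a := by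
  refine cases (ε := Bool) (h := fun x => f x.1) hc hg (by fun_prop) fun a => ?_
  rcases h : c a
  · exact Or.inl ⟨rfl, rfl⟩
  · exact Or.inr ⟨true, _, _, rfl, rfl, rfl⟩

theorem listCases {l : α → List β} {g : α → γ} {h : α → β → List β → γ} (hl : PolyFun 𝔸 l)
    (hg : PolyFun 𝔸 g) (hh : PolyFun 𝔸 fun x : α × (β × List β) => h x.1 x.2.1 x.2.2) :
    PolyFun 𝔸 fun a => List.casesOn (motive := fun _ => γ) (l a) (g a) (h a) := by
  refine cases hl hg hh fun a => ?_
  rcases h : l a with _ | ⟨b, t⟩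
  · exact Or.inl ⟨rfl, rfl⟩
  · exact Or.inr ⟨(b, t), _, _, rfl, rfl, rfl⟩

theorem natCases {n : α → ℕ} {g : α → γ} {h : α → ℕ → γ} (hn : PolyFun 𝔸 n)
    (hg : PolyFun 𝔸 g) (hh : PolyFun 𝔸 fun x : α × ℕ => h x.1 x.2) :
    PolyFun 𝔸 fun a => Nat.casesOn (motive := fun _ => γ) (n a) (g a) (h a) := by
  refine cases (ε := Unit × ℕ) (h := fun x => h x.1 x.2.2) hn hg (by fun_prop) fun a => ?_
  rcases h : n a with _ | m
  · exact Or.inl ⟨rfl, rfl⟩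
  · exact Or.inr ⟨((), m), _, _, rfl, rfl, rfl⟩

@[fun_prop]
-- The pair `((), n)` and the number `n + 1` are the same tree, so after pairing nothing remains to
-- be computed.
theorem succ {n : α → ℕ} (hn : PolyFun 𝔸 n) : PolyFun 𝔸 fun a => n a + 1 :=
  comp (f := fun x : Unit × ℕ => x.2 + 1) (of_enc_eq fun _ => rfl) (pair (const ()) hn)

@[fun_prop]
theorem pred {n : α → ℕ} (hn : PolyFun 𝔸 n) : PolyFun 𝔸 fun a => n a - 1 := by
  have := natCases (g := fun _ => 0) (h := fun _ m => m) hn (by fun_prop) (by fun_prop)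
  refine (congrArg (PolyFun 𝔸) (funext fun a => ?_)).mp this
  cases n a <;> rfl

@[fun_prop]
theorem cons {f : α → β} {l : α → List β} (hf : PolyFun 𝔸 f) (hl : PolyFun 𝔸 l) :
    PolyFun 𝔸 fun a => f a :: l a :=
  comp (f := fun x : β × List β => x.1 :: x.2) (of_enc_eq fun _ => rfl) (pair hf hl)

@[fun_prop]
theorem tail {l : α → List β} (hl : PolyFun 𝔸 l) : PolyFun 𝔸 fun a => (l a).tail := by
  have := listCases (g := fun _ => []) (h := fun _ _ t => t) hl (by fun_prop) (by fun_prop)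
  refine (congrArg (PolyFun 𝔸) (funext fun a => ?_)).mp this
  cases l a <;> rfl

@[fun_prop]
theorem headD {l : α → List β} (hl : PolyFun 𝔸 l) (d : β) : PolyFun 𝔸 fun a => (l a).headD d := by
  have := listCases (g := fun _ => d) (h := fun _ b _ => b) hl (by fun_prop) (by fun_prop)
  refine (congrArg (PolyFun 𝔸) (funext fun a => ?_)).mp this
  cases l a <;> rfl

/-- Iteration of a function that depends on a parameter. -/
theorem iterate' {n : α → δ} {g : α → β} {f : α → β → β} (hn : PolyFun 𝔸 n) (hg : PolyFun 𝔸 g)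
    (hf : PolyFun 𝔸 fun x : α × β => f x.1 x.2) {s : α → ℕ} (hs : PolyBounded s)
    (hb : ∀ a, ∀ k ≤ (enc (n a)).spine, sz ((f a)^[k] (g a)) ≤ s a) :
    PolyFun 𝔸 fun a => (f a)^[(enc (n a)).spine] (g a) := by
  have e : ∀ a k, (fun x : α × β => (x.1, f x.1 x.2))^[k] (a, g a) = (a, (f a)^[k] (g a)) := by
    intro a k
    induction k with
    | zero => rfl
    | succ k ih => rw [Function.iterate_succ_apply', ih, Function.iterate_succ_apply']
  have := iterate hn (pair id hg) (f := fun x : α × β => (x.1, f x.1 x.2)) (pair (fst id) hf) ((PolyBounded.size.add hs).add (.const 1))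
    fun a k hk => by rw [e, sz_prod]; have := hb a k hk; omega
  simpa only [e] using snd this

theorem iterateNat {n : α → ℕ} {g : α → β} {f : α → β → β} (hn : PolyFun 𝔸 n) (hg : PolyFun 𝔸 g)
    (hf : PolyFun 𝔸 fun x : α × β => f x.1 x.2) {s : α → ℕ} (hs : PolyBounded s)
    (hb : ∀ a, ∀ k ≤ n a, sz ((f a)^[k] (g a)) ≤ s a) : PolyFun 𝔸 fun a => (f a)^[n a] (g a) := by
  simpa only [spine_nat] using iterate' hn hg hf hs (by simpa only [spine_nat] using hb)

/-- A fold whose intermediate values have polynomially bounded sizes. -/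
theorem foldl {l : α → List γ} {b : α → β} {f : α → β → γ → β} (hl : PolyFun 𝔸 l) (hb : PolyFun 𝔸 b)
    (hf : PolyFun 𝔸 fun x : α × (β × γ) => f x.1 x.2.1 x.2.2) {s : α → ℕ} (hs : PolyBounded s)
    (hbd : ∀ a k, sz (((l a).take k).foldl (f a) (b a)) ≤ s a) :
    PolyFun 𝔸 fun a => (l a).foldl (f a) (b a) := by
  -- One pass acts on the remaining list and the accumulator. The original list serves as the
  -- counter, since its right branch is as long as the list.
  let F : α → List γ × β → List γ × β := fun a x =>
    List.casesOn (motive := fun _ => List γ × β) x.1 ([], x.2) fun c t => (t, f a x.2 c)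
  have hF : PolyFun 𝔸 fun x : α × (List γ × β) => F x.1 x.2 :=
    listCases (l := fun x : α × (List γ × β) => x.2.1) (g := fun x => ([], x.2.2))
      (h := fun x c t => (t, f x.1 x.2.2 c)) (by fun_prop) (by fun_prop) (by fun_prop)
  have e : ∀ a k (t : List γ) b, (F a)^[k] (t, b) = (t.drop k, (t.take k).foldl (f a) b) := by
    intro a k
    induction k with
    | zero => simp
    | succ k ih =>
      intro t b
      rw [Function.iterate_succ_apply]
      cases t with
      | nil => simp [F, ih]
      | cons c t => simp [F, ih]
  have := iterate' hl (pair hl hb) hF ((hl.bounded.add hs).add (.const 1)) fun a k _ => by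
    rw [e, sz_prod]
    have := hbd a k
    have := sz_drop_le (l a) k
    omega
  simpa [e, spine_list] using snd this

@[fun_prop]
theorem reverse {l : α → List β} (hl : PolyFun 𝔸 l) : PolyFun 𝔸 fun a => (l a).reverse := by
  have e : ∀ l r : List β, l.foldl (fun r b => b :: r) r = l.reverse ++ r := fun l => by
    induction l with
    | nil => simp
    | cons b l ih => simp [ih]
  have := foldl (b := fun _ => []) (f := fun _ r b => b :: r) hl (const []) (by fun_prop)
    hl.bounded fun a k => by
      rw [e, List.append_nil, sz_reverse]; exact sz_take_le _ _
  simpa [e] using this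

theorem foldr {l : α → List γ} {b : α → β} {f : α → γ → β → β} (hl : PolyFun 𝔸 l) (hb : PolyFun 𝔸 b)
    (hf : PolyFun 𝔸 fun x : α × (γ × β) => f x.1 x.2.1 x.2.2) {s : α → ℕ} (hs : PolyBounded s)
    (hbd : ∀ a, ∀ t, t <:+ l a → sz (t.foldr (f a) (b a)) ≤ s a) :
    PolyFun 𝔸 fun a => (l a).foldr (f a) (b a) := by
  have := foldl (f := fun a b c => f a c b) (reverse hl) hb (by fun_prop) hs fun a k => by
    rw [List.take_reverse, List.foldl_reverse]
    exact hbd a _ (List.drop_suffix _ _)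
  simpa only [List.foldl_reverse] using this

theorem map {l : α → List β} {f : α → β → γ} (hl : PolyFun 𝔸 l)
    (hf : PolyFun 𝔸 fun x : α × β => f x.1 x.2) : PolyFun 𝔸 fun a => (l a).map (f a) := by
  obtain ⟨p, hp⟩ := hf.bounded
  have e : ∀ a (t : List β), t.foldr (fun b r => f a b :: r) [] = t.map (f a) := fun a t => by
    induction t with
    | nil => rfl
    | cons b t ih => simp [ih]
  have b := hl.bounded
  have := foldr (b := fun _ => []) (f := fun a b r => f a b :: r) hl (const []) (by fun_prop)
    ((b.mul ((((PolyBounded.size.add b).add (.const 1)).eval p).add (.const 1))).add (.const 1))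
    fun a t ht => by
      rw [e]
      refine (sz_list_le _ (p.eval (sz a + sz (l a) + 1)) fun c hc => ?_).trans ?_
      · obtain ⟨b, hb, rfl⟩ := List.mem_map.1 hc
        refine (hp (a, b)).trans (eval_mono p ?_)
        rw [sz_prod]
        have := sz_lt_of_mem (ht.subset hb)
        omega
      · rw [List.length_map]
        gcongr
        exact (ht.length_le).trans (length_lt_sz _).le
  simpa [e] using this

@[fun_prop]
theorem append {l l' : α → List β} (hl : PolyFun 𝔸 l) (hl' : PolyFun 𝔸 l') :
    PolyFun 𝔸 fun a => l a ++ l' a := by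
  have e : ∀ t r : List β, t.foldr (fun b r => b :: r) r = t ++ r := fun t r => by
    induction t with
    | nil => rfl
    | cons b t ih => simp [ih]
  have := foldr (f := fun _ b r => b :: r) hl hl' (by fun_prop) (hl.bounded.add hl'.bounded)
    fun a t ht => by
      rw [e]
      have := sz_append t (l' a)
      have := sz_le_of_suffix ht
      omega
  simpa [e] using this

theorem flatMap {l : α → List β} {f : α → β → List γ} (hl : PolyFun 𝔸 l)
    (hf : PolyFun 𝔸 fun x : α × β => f x.1 x.2) : PolyFun 𝔸 fun a => (l a).flatMap (f a) := by
  have e : ∀ a (t : List β), (t.map (f a)).foldr (fun b r => b ++ r) [] = t.flatMap (f a) :=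
    fun a t => by
      induction t with
      | nil => rfl
      | cons b t ih => simp [← ih]
  have hsz : ∀ L : List (List γ), sz (L.foldr (fun b r => b ++ r) []) ≤ sz L := fun L => by
    induction L with
    | nil => simp
    | cons b L ih => simp; have := sz_append b (L.foldr (fun b r => b ++ r) []); omega
  have hm := map hl hf
  have := foldr (b := fun _ => []) (f := fun _ b r => b ++ r) hm (const []) (by fun_prop)
    hm.bounded fun a t ht => (hsz t).trans (sz_le_of_suffix ht)
  simpa only [e] using this

@[fun_prop]
theorem length {l : α → List β} (hl : PolyFun 𝔸 l) : PolyFun 𝔸 fun a => (l a).length := by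
  have e : ∀ n k, (fun m => m + 1)^[k] n = n + k := fun n k => by
    induction k with
    | zero => rfl
    | succ k ih => rw [Function.iterate_succ_apply', ih]; rfl
  have := iterate' (g := fun _ => 0) (f := fun _ m => m + 1) hl (const 0) (by fun_prop)
    ((PolyBounded.const 2).mul hl.bounded) fun a k hk => by
      rw [e, sz_nat]
      rw [spine_list] at hk
      have := length_lt_sz (l a)
      omega
  simpa [e, spine_list] using this

@[fun_prop]
theorem add {m n : α → ℕ} (hm : PolyFun 𝔸 m) (hn : PolyFun 𝔸 n) : PolyFun 𝔸 fun a => m a + n a := by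
  have e : ∀ n k, (fun m => m + 1)^[k] n = n + k := fun n k => by
    induction k with
    | zero => rfl
    | succ k ih => rw [Function.iterate_succ_apply', ih]; rfl
  have := iterateNat (f := fun _ m => m + 1) hn hm (by fun_prop) (hm.bounded.add hn.bounded)
    fun a k hk => by simp only [e, sz_nat]; omega
  simpa only [e] using this

@[fun_prop]
theorem sub {m n : α → ℕ} (hm : PolyFun 𝔸 m) (hn : PolyFun 𝔸 n) : PolyFun 𝔸 fun a => m a - n a := by
  have e : ∀ n k, (fun m => m - 1)^[k] n = n - k := fun n k => by
    induction k with
    | zero => rfl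
    | succ k ih => rw [Function.iterate_succ_apply', ih]; rfl
  have := iterateNat (f := fun _ m => m - 1) hn hm (by fun_prop) hm.bounded
    fun a k hk => by simp only [e, sz_nat]; omega
  simpa only [e] using this

@[fun_prop]
theorem drop {n : α → ℕ} {l : α → List β} (hn : PolyFun 𝔸 n) (hl : PolyFun 𝔸 l) :
    PolyFun 𝔸 fun a => (l a).drop (n a) := by
  have e : ∀ (l : List β) k, List.tail^[k] l = l.drop k := fun l k => by
    induction k with
    | zero => rfl
    | succ k ih => rw [Function.iterate_succ_apply', ih, List.tail_drop]
  have := iterateNat (f := fun _ l => List.tail l) hn hl (by fun_prop) hl.bounded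
    fun a k hk => by rw [e]; exact sz_drop_le _ _
  simpa only [e] using this

@[fun_prop]
theorem getD {n : α → ℕ} {l : α → List β} (hl : PolyFun 𝔸 l) (hn : PolyFun 𝔸 n) (d : β) :
    PolyFun 𝔸 fun a => (l a).getD (n a) d := by
  have : PolyFun 𝔸 fun a => ((l a).drop (n a)).headD d := by fun_prop
  simpa [List.headD_eq_head?_getD, List.head?_drop] using this

@[fun_prop]
theorem range {n : α → ℕ} (hn : PolyFun 𝔸 n) : PolyFun 𝔸 fun a => List.range (n a) := by
  -- Counting down and prepending makes the numbers come out in increasing order.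
  let F : ℕ × List ℕ → ℕ × List ℕ := fun x => (x.1 - 1, (x.1 - 1) :: x.2)
  have e : ∀ n k, k ≤ n → F^[k] (n, []) = (n - k, List.range' (n - k) k) := by
    intro n k hk
    induction k with
    | zero => rfl
    | succ k ih =>
      rw [Function.iterate_succ_apply', ih (by omega), List.range'_succ]
      simp only [F, Nat.sub_sub]
      rw [show n - (k + 1) + 1 = n - k by omega]
  have b := hn.bounded
  have := iterateNat (g := fun a => (n a, ([] : List ℕ))) (f := fun _ => F) hn (by fun_prop)
    (by fun_prop) ((b.add ((b.mul (b.add (.const 1))).add (.const 1))).add (.const 1))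
    fun a k hk => by
      rw [e _ _ hk, sz_prod]
      have h := sz_list_le (List.range' (n a - k) k) (sz (n a)) fun x hx => by
        rw [List.mem_range'_1] at hx
        simp only [sz_nat]
        omega
      rw [List.length_range'] at h
      have h2 : k * (sz (n a) + 1) ≤ sz (n a) * (sz (n a) + 1) :=
        Nat.mul_le_mul_right _ (by rw [sz_nat]; omega)
      have : sz (n a - k) ≤ sz (n a) := by simp only [sz_nat]; omega
      omega
  refine (congrArg (PolyFun 𝔸) (funext fun a => ?_)).mp (snd this)
  rw [e _ _ le_rfl, Nat.sub_self, List.range_eq_range']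

theorem countP {l : α → List β} {f : α → β → Bool} (hl : PolyFun 𝔸 l)
    (hf : PolyFun 𝔸 fun x : α × β => f x.1 x.2) : PolyFun 𝔸 fun a => (l a).countP (f a) := by
  have e : ∀ a (t : List β),
      t.foldr (fun b r => bif f a b then r + 1 else r) 0 = t.countP (f a) := fun a t => by
    induction t with
    | nil => rfl
    | cons b t ih => rw [List.foldr_cons, ih, List.countP_cons]; cases f a b <;> rfl
  have := foldr (b := fun _ => 0) (f := fun a b r => bif f a b then r + 1 else r) hl (const 0)
    (by fun_prop) ((PolyBounded.const 2).mul hl.bounded) fun a t ht => by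
      rw [e, sz_nat]
      have h1 := List.countP_le_length (p := f a) (l := t)
      have h2 := ht.length_le
      have h3 := length_lt_sz (l a)
      omega
  simpa only [e] using this

end PolyFun

/-! ### Predicates that are decidable in polynomial time -/

/-- The predicate `P` can be decided in polynomial time. -/
def PolyPred (𝔸 : Ambient) {α : Type} [Enc α] (P : α → Prop) : Prop :=
  ∃ f : α → Bool, PolyFun 𝔸 f ∧ ∀ a, f a = true ↔ P a

namespace PolyPred

variable {α β γ : Type} [Enc α] [Enc β] [Enc γ] {P Q : α → Prop}

theorem decide (h : PolyPred 𝔸 P) [DecidablePred P] : PolyFun 𝔸 fun a => decide (P a) := by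
  obtain ⟨f, hf, hP⟩ := h
  refine (congrArg (PolyFun 𝔸) (funext fun a => ?_)).mp hf
  rw [Bool.eq_iff_iff, hP, decide_eq_true_iff]

theorem congr (h : PolyPred 𝔸 P) (e : ∀ a, P a ↔ Q a) : PolyPred 𝔸 Q :=
  let ⟨f, hf, hP⟩ := h; ⟨f, hf, fun a => (hP a).trans (e a)⟩

theorem of_bool {f : α → Bool} (hf : PolyFun 𝔸 f) : PolyPred 𝔸 fun a => f a = true :=
  ⟨f, hf, fun _ => Iff.rfl⟩

theorem const (p : Prop) : PolyPred 𝔸 fun _ : α => p := by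
  classical exact ⟨fun _ => Decidable.decide p, by fun_prop, fun _ => by simp⟩

theorem comp {P : β → Prop} {f : α → β} (h : PolyPred 𝔸 P) (hf : PolyFun 𝔸 f) :
    PolyPred 𝔸 fun a => P (f a) :=
  let ⟨g, hg, hP⟩ := h; ⟨fun a => g (f a), hg.comp hf, fun a => hP (f a)⟩

theorem not (h : PolyPred 𝔸 P) : PolyPred 𝔸 fun a => ¬ P a :=
  let ⟨f, hf, hP⟩ := h
  ⟨fun a => bif f a then false else true, by fun_prop, fun a => by
    have := hP a; cases h : f a <;> simp_all⟩

theorem and (h : PolyPred 𝔸 P) (h' : PolyPred 𝔸 Q) : PolyPred 𝔸 fun a => P a ∧ Q a :=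
  let ⟨f, hf, hP⟩ := h; let ⟨g, hg, hQ⟩ := h'
  ⟨fun a => bif f a then g a else false, by fun_prop, fun a => by
    have := hP a; have := hQ a; cases h : f a <;> simp_all⟩

theorem or (h : PolyPred 𝔸 P) (h' : PolyPred 𝔸 Q) : PolyPred 𝔸 fun a => P a ∨ Q a :=
  (h.not.and h'.not).not.congr fun a => by tauto

theorem imp (h : PolyPred 𝔸 P) (h' : PolyPred 𝔸 Q) : PolyPred 𝔸 fun a => P a → Q a :=
  (h.and h'.not).not.congr fun a => by tauto

theorem iff (h : PolyPred 𝔸 P) (h' : PolyPred 𝔸 Q) : PolyPred 𝔸 fun a => (P a ↔ Q a) :=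
  ((h.imp h').and (h'.imp h)).congr fun a => by tauto

theorem eq_zero {n : α → ℕ} (hn : PolyFun 𝔸 n) : PolyPred 𝔸 fun a => n a = 0 :=
  ⟨_, PolyFun.natCases (g := fun _ => true) (h := fun _ _ => false) hn (by fun_prop) (by fun_prop),
    fun a => by cases h : n a <;> simp [h]⟩

theorem le {m n : α → ℕ} (hm : PolyFun 𝔸 m) (hn : PolyFun 𝔸 n) : PolyPred 𝔸 fun a => m a ≤ n a :=
  (eq_zero (n := fun a => m a - n a) (by fun_prop)).congr fun a => by omega

theorem lt {m n : α → ℕ} (hm : PolyFun 𝔸 m) (hn : PolyFun 𝔸 n) : PolyPred 𝔸 fun a => m a < n a :=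
  (le (hm.succ) hn).congr fun a => by omega

theorem eq {m n : α → ℕ} (hm : PolyFun 𝔸 m) (hn : PolyFun 𝔸 n) : PolyPred 𝔸 fun a => m a = n a :=
  ((le hm hn).and (le hn hm)).congr fun a => by omega

theorem forall_mem {l : α → List β} {P : α → β → Prop} (hl : PolyFun 𝔸 l)
    (h : PolyPred 𝔸 fun x : α × β => P x.1 x.2) : PolyPred 𝔸 fun a => ∀ b ∈ l a, P a b := by
  obtain ⟨f, hf, hP⟩ := h.not
  refine (eq_zero (PolyFun.countP (f := fun a b => f (a, b)) hl (by fun_prop))).congr fun a => ?_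
  simp [List.countP_eq_zero, hP]

theorem forall_lt {n : α → ℕ} {P : α → ℕ → Prop} (hn : PolyFun 𝔸 n)
    (h : PolyPred 𝔸 fun x : α × ℕ => P x.1 x.2) : PolyPred 𝔸 fun a => ∀ i < n a, P a i :=
  (forall_mem hn.range h).congr fun a => by simp

theorem list_eq (d : β) {l l' : α → List β} (hl : PolyFun 𝔸 l) (hl' : PolyFun 𝔸 l')
    (h : PolyPred 𝔸 fun x : β × β => x.1 = x.2) : PolyPred 𝔸 fun a => l a = l' a := by
  refine ((eq hl.length hl'.length).and (forall_lt hl.length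
    (P := fun a i => (l a).getD i d = (l' a).getD i d)
    (h.comp (f := fun x : α × ℕ => ((l x.1).getD x.2 d, (l' x.1).getD x.2 d))
      (by fun_prop)))).congr fun a => ⟨fun ⟨e, h⟩ => ?_, fun e => by simp [e]⟩
  refine List.ext_getElem e fun i h1 h2 => ?_
  have := h i h1
  rwa [List.getD_eq_getElem _ _ h1, List.getD_eq_getElem _ _ h2] at this

end PolyPred

namespace PolyFun

variable {α β γ : Type} [Enc α] [Enc β] [Enc γ]

theorem ite {P : α → Prop} [DecidablePred P] {f g : α → β} (hP : PolyPred 𝔸 P) (hf : PolyFun 𝔸 f)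
    (hg : PolyFun 𝔸 g) : PolyFun 𝔸 fun a => if P a then f a else g a := by
  have := cond hP.decide hf hg
  simpa only [Bool.cond_decide] using this

theorem card_filter {n : α → ℕ} {P : α → ℕ → Prop} [∀ a, DecidablePred (P a)] (hn : PolyFun 𝔸 n)
    (h : PolyPred 𝔸 fun x : α × ℕ => P x.1 x.2) :
    PolyFun 𝔸 fun a => ((Finset.range (n a)).filter (P a)).card := by
  have := countP (f := fun a i => decide (P a i)) hn.range
    (@PolyPred.decide _ _ _ _ h fun x => inferInstanceAs (Decidable (P x.1 x.2)))
  refine (congrArg (PolyFun 𝔸) (funext fun a => ?_)).mp this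
  rw [List.countP_eq_length_filter]
  rfl

/-- Every function on a finite type whose elements are represented by different numbers. -/
theorem of_finite [Finite α] (code : α → ℕ) (hc : ∀ a, enc a = enc (code a))
    (hinj : Function.Injective code) (f : α → β) : PolyFun 𝔸 f := by
  classical
  have := Fintype.ofFinite α
  have hcode : PolyFun 𝔸 code := of_enc_eq fun a => (hc a).symm
  -- A table of conditionals on the code, extended by one element at a time until it covers the
  -- whole type.
  suffices H : ∀ l : List α, ∃ g : α → β, PolyFun 𝔸 g ∧ ∀ a ∈ l, g a = f a by
    obtain ⟨g, hg, h⟩ := H Finset.univ.toList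
    rwa [show f = g from funext fun a => (h a (by simp)).symm]
  intro l
  induction l with
  | nil =>
    rcases isEmpty_or_nonempty α with h | ⟨⟨a⟩⟩
    · exact ⟨f, ⟨⟨0, fun a => h.elim a⟩, Frag.skip, fun _ => 0, ⟨0, fun a => h.elim a⟩,
        fun a => h.elim a⟩, by simp⟩
    · exact ⟨fun _ => f a, const _, by simp⟩
  | cons x l ih =>
    obtain ⟨g, hg, h⟩ := ih
    refine ⟨fun a => if code a = code x then f x else g a,
      ite (.eq hcode (const _)) (const _) hg, fun a ha => ?_⟩
    by_cases e : code a = code x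
    · simp [hinj e]
    · simpa [e] using h a ((List.mem_cons.1 ha).resolve_left fun e' => e (by rw [e']))

end PolyFun

end PolyTime

namespace TRVB

/-! ### Components by merging labels -/

section Label

variable {α β : Type} [DecidableEq α] [DecidableEq β]

/-- Merge the classes of the ends of `e`. -/
def relabel (L : α → α) (e : α × α) : α → α := fun i => if L i = L e.1 then L e.2 else L i

/-- Labels for the components of the graph with the given list of edges. -/
def label (es : List (α × α)) : α → α := es.foldl relabel id

theorem label_append (es : List (α × α)) (e : α × α) :
    label (es ++ [e]) = relabel (label es) e := by simp [label]

theorem label_label (es : List (α × α)) (i : α) : label es (label es i) = label es i := by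
  induction es using List.reverseRecOn generalizing i with
  | nil => rfl
  | append_singleton es e ih => rw [label_append]; simp only [relabel]; grind

/-- Induction on the last edge `e`: relabelling moves the class of `e.1` into that of `e.2` and
leaves all other classes alone, just as adding one generator to the equivalence relation does. -/
theorem label_eq_iff (es : List (α × α)) (i j : α) :
    label es i = label es j ↔ Relation.EqvGen (fun x y => (x, y) ∈ es) i j := by
  constructor
  · induction es using List.reverseRecOn generalizing i j with
    | nil => rintro rfl; exact .refl _
    | append_singleton es e ih =>
      have h1 : ∀ x y, label es x = label es y →
          Relation.EqvGen (fun x y => (x, y) ∈ es ++ [e]) x y := fun x y h =>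
        Relation.EqvGen.mono (r := fun x y => (x, y) ∈ es)
          (fun x y h => List.mem_append_left _ h) x y (ih x y h)
      have h2 : Relation.EqvGen (fun x y => (x, y) ∈ es ++ [e]) e.1 e.2 := .rel _ _ (by simp)
      rw [label_append]
      simp only [relabel]
      intro h
      split_ifs at h with hi hj hj
      · exact h1 _ _ (hi.trans hj.symm)
      · exact ((h1 _ _ hi).trans _ _ _ h2).trans _ _ _ (h1 _ _ h)
      · exact ((h1 _ _ h).trans _ _ _ (h2.symm _ _)).trans _ _ _ ((h1 _ _ hj).symm _ _)
      · exact h1 _ _ h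
  · intro h
    induction h with
    | rel x y h =>
      induction es using List.reverseRecOn with
      | nil => simp at h
      | append_singleton es e ih =>
        rw [label_append]
        simp only [relabel]
        rcases List.mem_append.1 h with h | h
        · rw [ih h]
        · simp only [List.mem_singleton] at h
          subst h
          simp
    | refl x => rfl
    | symm x y _ ih => exact ih.symm
    | trans x y z _ _ ih ih' => exact ih.trans ih'

/-- Labels are only compared and copied. This transports them from a graph to numbers, even if some
numbers are not names of vertices. -/
theorem label_map {g : α → β} (hg : Function.Injective g) (es : List (α × α)) (i : α) :
    label (es.map (Prod.map g g)) (g i) = g (label es i) := by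
  induction es using List.reverseRecOn generalizing i with
  | nil => rfl
  | append_singleton es e ih =>
    rw [List.map_append, List.map_singleton, label_append, label_append]
    simp only [relabel, Prod.map_fst, Prod.map_snd, ih, hg.eq_iff]
    split_ifs <;> rfl

/-- The number of classes of a relation whose classes are distinguished by labels. -/
theorem card_quot_eq (es : List (α × α)) {r : α → α → Prop}
    (hr : ∀ x y, Quot.mk r x = Quot.mk r y ↔ label es x = label es y) :
    Nat.card (Quot r) = Nat.card {v // label es v = v} := by
  refine (Nat.card_congr (Equiv.ofBijective
    (fun v : {v // label es v = v} => Quot.mk r v.1) ⟨fun v w h => ?_, fun q => ?_⟩)).symm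
  · have := (hr _ _).1 h
    rw [v.2, w.2] at this
    exact Subtype.ext this
  · obtain ⟨x, rfl⟩ := Quot.exists_rep q
    exact ⟨⟨label es x, label_label es x⟩, (hr _ _).2 (label_label es x)⟩

/-- No edge of the list joins two vertices that are joined by the edges before it. -/
def IsIndep (es : List (α × α)) : Prop :=
  ∀ k (h : k < es.length), label (es.take k) es[k].1 ≠ label (es.take k) es[k].2

theorem isIndep_append (es : List (α × α)) (e : α × α) :
    IsIndep (es ++ [e]) ↔ IsIndep es ∧ label es e.1 ≠ label es e.2 := by
  constructor
  · refine fun h => ⟨fun k hk => ?_, ?_⟩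
    · have := h k (by simp; omega)
      rwa [List.getElem_append_left hk, List.take_append_of_le_length hk.le] at this
    · simpa using h es.length (by simp)
  · rintro ⟨h, he⟩ k hk
    rcases Nat.lt_or_ge k es.length with h' | h'
    · rw [List.getElem_append_left h', List.take_append_of_le_length h'.le]
      exact h k h'
    · obtain rfl : k = es.length := by simp at hk; omega
      simpa using he

/-- The classes are counted by their representatives, the fixed points of the labelling. An edge
between different classes removes exactly one representative, the label of its first end; any other
edge changes nothing. So equality holds iff every edge merges two classes. -/
theorem card_label [Finite α] (es : List (α × α)) :
    Nat.card α ≤ Nat.card {v // label es v = v} + es.length ∧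
      (Nat.card α = Nat.card {v // label es v = v} + es.length ↔ IsIndep es) := by
  classical
  have := Fintype.ofFinite α
  simp only [Nat.card_eq_fintype_card, Fintype.card_subtype]
  induction es using List.reverseRecOn with
  | nil => simp [label, IsIndep]
  | append_singleton es e ih =>
    rw [isIndep_append, label_append, List.length_append, List.length_singleton]
    by_cases he : label es e.1 = label es e.2
    · have : relabel (label es) e = label es := by
        funext i; simp only [relabel]; split_ifs with h
        · rw [← he, h]
        · rfl
      rw [this]
      refine ⟨by omega, ⟨fun h => by omega, fun h => absurd he h.2⟩⟩
    · have : (Finset.univ.filter fun v => relabel (label es) e v = v) =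
          (Finset.univ.filter fun v => label es v = v).erase (label es e.1) := by
        ext v
        simp only [Finset.mem_filter, Finset.mem_univ, true_and, Finset.mem_erase, relabel]
        have h1 := label_label es e.1
        have h2 := label_label es e.2
        grind
      rw [this, Finset.card_erase_of_mem (by simp [label_label])]
      have : 0 < (Finset.univ.filter fun v => label es v = v).card :=
        Finset.card_pos.2 ⟨label es e.1, by simp [label_label]⟩
      refine ⟨by omega, ?_⟩
      rw [← ih.2]
      constructor
      · exact fun h => ⟨by omega, he⟩
      · exact fun h => by omega

/-- The cycles of a permutation as classes of labels. -/
theorem label_eq_iff_sameCycle [Finite α] (es : List (α × α)) (π : Equiv.Perm α)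
    (h : ∀ x y, (x, y) ∈ es ↔ y = π x) (x y : α) :
    label es x = label es y ↔ π.SameCycle x y := by
  rw [label_eq_iff]
  constructor
  · intro h'
    induction h' with
    | rel x y hxy => rw [(h x y).1 hxy]; exact ⟨1, by simp⟩
    | refl x => exact .refl _ _
    | symm x y _ ih => exact ih.symm
    | trans x y z _ _ ih ih' => exact ih.trans ih'
  · intro h'
    -- By finiteness a natural power of `π` suffices, which is reached by repeated forward steps.
    obtain ⟨n, -, rfl⟩ := h'.exists_nat_pow_eq
    clear h'
    induction n with
    | zero => exact .refl _
    | succ n ih =>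
      refine ih.trans _ _ _ (.rel _ _ ((h _ _).2 ?_))
      rw [pow_succ']; rfl

end Label

/-! ### Trees recognised by counting classes and vertices -/

namespace Multigraph

variable {V : Type} {m : ℕ} (G : Multigraph V (Fin m))

/-- The list of the pairs of ends of the edges. -/
def ends : List (V × V) := List.ofFn fun e => (G.endpoint (e, false), G.endpoint (e, true))

theorem length_ends : G.ends.length = m := by simp [ends]

theorem isLink_iff (e : Fin m) (x y : V) : G.toGraph.IsLink e x y ↔
    (G.endpoint (e, false) = x ∧ G.endpoint (e, true) = y) ∨
      (G.endpoint (e, false) = y ∧ G.endpoint (e, true) = x) := by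
  rw [← Sym2.eq_iff]; rfl

theorem adj_iff (x y : V) : G.toGraph.Adj x y ↔ (x, y) ∈ G.ends ∨ (y, x) ∈ G.ends := by
  simp only [Graph.Adj, isLink_iff, ends, List.mem_ofFn, Prod.mk.injEq, exists_or]

theorem eqvGen_adj_iff (x y : V) : Relation.EqvGen G.toGraph.Adj x y ↔
    Relation.EqvGen (fun x y => (x, y) ∈ G.ends) x y := by
  constructor
  · intro h
    induction h with
    | rel x y h =>
      rcases (G.adj_iff x y).1 h with h | h
      · exact .rel _ _ h
      · exact .symm _ _ (.rel _ _ h)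
    | refl x => exact .refl _
    | symm x y _ ih => exact .symm _ _ ih
    | trans x y z _ _ ih ih' => exact .trans _ _ _ ih ih'
  · exact Relation.EqvGen.mono (fun x y h => (G.adj_iff x y).2 (Or.inl h)) x y

theorem reflTransGen_adj_iff (x y : V) : Relation.ReflTransGen G.toGraph.Adj x y ↔
    Relation.EqvGen G.toGraph.Adj x y := by
  have hs : ∀ x y, G.toGraph.Adj x y → G.toGraph.Adj y x := fun x y h =>
    (G.adj_iff y x).2 ((G.adj_iff x y).1 h).symm
  constructor
  · intro h
    induction h with
    | refl => exact .refl _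
    | tail _ h ih => exact ih.trans _ _ _ (.rel _ _ h)
  · intro h
    induction h with
    | rel x y h => exact .single h
    | refl x => exact .refl
    | symm x y _ ih =>
      have : Std.Symm G.toGraph.Adj := ⟨hs⟩
      exact Relation.ReflTransGen.stdSymm.symm _ _ ih
    | trans x y z _ _ ih ih' => exact ih.trans ih'

variable [DecidableEq V]

theorem quot_adj_eq_iff (x y : V) :
    Quot.mk G.toGraph.Adj x = Quot.mk G.toGraph.Adj y ↔ label G.ends x = label G.ends y := by
  rw [label_eq_iff, ← eqvGen_adj_iff]
  exact ⟨Quot.eqvGen_exact, Quot.eqvGen_sound⟩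

theorem componentCount_eq : G.componentCount = Nat.card {v // label G.ends v = v} :=
  card_quot_eq _ G.quot_adj_eq_iff

open Fin.NatCast Fin.CommRing in
-- In a cycle, take the edge that comes last in the list. The other edges of the cycle precede it
-- and connect its ends, so it does not merge two classes.
theorem not_hasCycle_of_isIndep (h : IsIndep G.ends) : ¬ G.HasCycle := by
  rintro ⟨k, c, f, -, hf, hl⟩
  obtain ⟨i, hi⟩ := Finite.exists_max f
  have hk : (f i : ℕ) < G.ends.length := by rw [length_ends]; exact (f i).2
  -- Walking around the cycle from `c (i + 1)`, all vertices have the same label; for `j = k` the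
  -- walk arrives at `c i`.
  have key : ∀ j ≤ k, label (G.ends.take (f i)) (c (i + 1 + (j : ℕ))) =
      label (G.ends.take (f i)) (c (i + 1)) := by
    intro j hj
    induction j with
    | zero => simp
    | succ j ih =>
      rw [← ih (by omega), label_eq_iff]
      -- Here `0 < 1 + j < k + 1`, so the walk has not yet come back to the edge `f i`.
      have hne : i + 1 + ((j : ℕ) : Fin (k + 1)) ≠ i := by
        intro h'
        rw [add_assoc, add_eq_left] at h'
        have h'' : ((1 + j : ℕ) : Fin (k + 1)) = 0 := by push_cast; exact h'
        exact absurd (Nat.le_of_dvd (by omega) (Fin.natCast_eq_zero.1 h'')) (by omega)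
      have hlt : f (i + 1 + ((j : ℕ) : Fin (k + 1))) < f i :=
        lt_of_le_of_ne (hi _) fun h' => hne (hf h')
      have hm : (G.endpoint (f (i + 1 + (j : ℕ)), false),
          G.endpoint (f (i + 1 + (j : ℕ)), true)) ∈ G.ends.take (f i) := by
        rw [List.mem_take_iff_getElem]
        exact ⟨f (i + 1 + (j : ℕ)), by simp [length_ends]; omega, by simp [ends]⟩
      have := (G.isLink_iff _ _ _).1 (hl (i + 1 + (j : ℕ)))
      rw [Nat.cast_succ, ← add_assoc]
      rcases this with ⟨h1, h2⟩ | ⟨h1, h2⟩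
      · rw [h1, h2] at hm; exact .symm _ _ (.rel _ _ hm)
      · rw [h1, h2] at hm; exact .rel _ _ hm
  have h1 := key k le_rfl
  rw [add_assoc, add_comm 1, ← Nat.cast_succ, Fin.natCast_self, add_zero] at h1
  have h2 := h (f i) hk
  simp only [ends, List.getElem_ofFn] at h2 h1
  rcases (G.isLink_iff _ _ _).1 (hl i) with ⟨e1, e2⟩ | ⟨e1, e2⟩
  · rw [e1, e2] at h2; exact h2 h1
  · rw [e1, e2] at h2; exact h2 h1.symm

/-- If the ends of the edge `k` are already connected by earlier edges, a path of such edges closes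
up with `k` to a cycle. A loop is the case of a path of length zero. -/
theorem hasCycle_of_not_isIndep (h : ¬ IsIndep G.ends) : G.HasCycle := by
  simp only [IsIndep, not_forall, not_not] at h
  obtain ⟨k, hk, h⟩ := h
  have hkm : k < m := by rwa [length_ends] at hk
  have e : G.ends[k] = (G.endpoint (⟨k, hkm⟩, false), G.endpoint (⟨k, hkm⟩, true)) := by
    simp [ends]
  rw [e, label_eq_iff] at h
  -- The simple graph of the earlier edges makes it possible to replace a walk by a path.
  let H : SimpleGraph V := SimpleGraph.fromRel fun x y =>
    ∃ e : Fin m, (e : ℕ) < k ∧ G.toGraph.IsLink e x y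
  have hr : ∀ x y, Relation.EqvGen (fun x y => (x, y) ∈ G.ends.take k) x y → H.Reachable x y := by
    intro x y h
    induction h with
    | rel x y h =>
      by_cases hxy : x = y
      · subst hxy; exact .refl _
      · refine SimpleGraph.Adj.reachable ((SimpleGraph.fromRel_adj _ _ _).2 ⟨hxy, Or.inl ?_⟩)
        rw [List.mem_take_iff_getElem] at h
        obtain ⟨j, hj, h⟩ := h
        refine ⟨⟨j, by rw [length_ends] at hj; omega⟩, by simp; omega, ?_⟩
        simp only [ends, List.getElem_ofFn, Prod.mk.injEq] at h
        exact (G.isLink_iff _ _ _).2 (Or.inl h)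
    | refl x => exact .refl _
    | symm x y _ ih => exact ih.symm
    | trans x y z _ _ ih ih' => exact ih.trans ih'
  obtain ⟨p, hp⟩ := (hr _ _ h).exists_isPath
  have hF : ∀ i < p.length, ∃ e : Fin m, (e : ℕ) < k ∧
      G.toGraph.IsLink e (p.getVert i) (p.getVert (i + 1)) := fun i hi => by
    obtain ⟨-, h | ⟨e, he, h⟩⟩ := (SimpleGraph.fromRel_adj _ _ _).1 (p.adj_getVert_succ hi)
    · exact h
    · exact ⟨e, he, h.symm⟩
  have : Nonempty (Fin m) := ⟨⟨k, hkm⟩⟩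
  choose! F hFk hFl using hF
  have hinj : ∀ i ≤ p.length, ∀ j ≤ p.length, p.getVert i = p.getVert j → i = j :=
    fun i hi j hj h => hp.getVert_injOn hi hj h
  refine ⟨p.length, fun i => p.getVert i, fun i => if (i : ℕ) < p.length then F i else ⟨k, hkm⟩,
    fun i j h => Fin.ext (hinj i (by omega) j (by omega) h), fun i j h => ?_, fun i => ?_⟩
  · beta_reduce at h
    split_ifs at h with hi hj hj
    · have h1 := hFl i hi
      have h2 := hFl j hj
      rw [h] at h1
      -- An edge used at positions `i` and `j` has the same two ends there. In the same direction
      -- this gives `i = j`; in opposite directions `i = j + 1` and `i + 1 = j`, which is absurd.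
      rcases h1.eq_and_eq_or_eq_and_eq h2 with ⟨a, -⟩ | ⟨a, b⟩
      · exact Fin.ext (hinj _ (by omega) _ (by omega) a)
      · have := hinj _ (by omega) _ (by omega) a
        have := hinj _ (by omega) _ (by omega) b
        omega
    · have := hFk i hi
      rw [h] at this
      exact absurd this (lt_irrefl k)
    · have := hFk j hj
      rw [← h] at this
      exact absurd this (lt_irrefl k)
    · exact Fin.ext (by omega)
  · beta_reduce
    split_ifs with hi
    · have : ((i + 1 : Fin (p.length + 1)) : ℕ) = i + 1 := Fin.val_add_one_of_lt (by
        rw [Fin.lt_def]; simpa using hi)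
      rw [this]
      exact hFl i hi
    · have hi : i = Fin.last _ := Fin.ext (by simp; omega)
      subst hi
      rw [Fin.last_add_one]
      simp only [Fin.val_last, Fin.val_zero, SimpleGraph.Walk.getVert_length,
        SimpleGraph.Walk.getVert_zero]
      exact (G.isLink_iff _ _ _).2 (Or.inr ⟨rfl, rfl⟩)

/-- Nonempty and connected means one class; acyclic means independent edges, which by `card_label`
is an equation between the numbers of vertices, classes and edges. -/
theorem isTree_iff [Finite V] : G.IsTree ↔
    Nat.card {v // label G.ends v = v} = 1 ∧ Nat.card V = m + 1 := by
  have h1 : (Nonempty V ∧ ∀ x y : V, Relation.ReflTransGen G.toGraph.Adj x y) ↔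
      Nat.card {v // label G.ends v = v} = 1 := by
    rw [← componentCount_eq, componentCount, Nat.card_eq_one_iff_unique]
    constructor
    · rintro ⟨⟨x⟩, h⟩
      refine ⟨⟨fun a b => ?_⟩, ⟨Quot.mk _ x⟩⟩
      induction a using Quot.ind
      induction b using Quot.ind
      exact Quot.eqvGen_sound ((G.reflTransGen_adj_iff _ _).1 (h _ _))
    · rintro ⟨h, ⟨q⟩⟩
      obtain ⟨x, -⟩ := Quot.exists_rep q
      exact ⟨⟨x⟩, fun x y => (G.reflTransGen_adj_iff _ _).2
        (Quot.eqvGen_exact (Subsingleton.elim _ _))⟩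
  have h2 : ¬ G.HasCycle ↔ IsIndep G.ends :=
    ⟨fun h => not_not.1 fun h' => h (G.hasCycle_of_not_isIndep h'), G.not_hasCycle_of_isIndep⟩
  have h3 := (card_label G.ends).2
  rw [length_ends] at h3
  rw [IsTree, ← and_assoc, h1, h2, ← h3]
  constructor
  · rintro ⟨a, b⟩; exact ⟨a, by omega⟩
  · rintro ⟨a, b⟩; exact ⟨a, by omega⟩

end Multigraph

end TRVB

open PolyTime PolyTime.Enc

namespace PolyTime.PolyFun

variable {𝔸 : Ambient} {α β : Type} [Enc α] [Enc β]

@[fun_prop]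
theorem ite_eq {m n : α → ℕ} {f g : α → β} (hm : PolyFun 𝔸 m) (hn : PolyFun 𝔸 n) (hf : PolyFun 𝔸 f)
    (hg : PolyFun 𝔸 g) : PolyFun 𝔸 fun a => if m a = n a then f a else g a :=
  ite (.eq hm hn) hf hg

theorem half {n : α → ℕ} (hn : PolyFun 𝔸 n) : PolyFun 𝔸 fun a => n a / 2 := by
  have := card_filter (P := fun a i => i + i + 2 ≤ n a) hn (.le (by fun_prop) (by fun_prop))
  refine (congrArg (PolyFun 𝔸) (funext fun a => ?_)).mp this
  have : (Finset.range (n a)).filter (fun i => i + i + 2 ≤ n a) = Finset.range (n a / 2) := by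
    ext i; simp; omega
  rw [this, Finset.card_range]

end PolyTime.PolyFun

namespace TRVB

/-! ### Labels as lists -/

/-- The list of the labels of the vertices `0, …, N - 1`. -/
def labelList (N : ℕ) (es : List (ℕ × ℕ)) : List ℕ :=
  es.foldl (fun L e => L.map fun l => if l = L.getD e.1 0 then L.getD e.2 0 else l) (List.range N)

/-- All ends are below `N`, so every lookup hits the list and the default value `0` plays no role.
-/
theorem labelList_eq {N : ℕ} {es : List (ℕ × ℕ)} (h : ∀ e ∈ es, e.1 < N ∧ e.2 < N) :
    labelList N es = (List.range N).map (label es) := by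
  induction es using List.reverseRecOn with
  | nil => simp [labelList, label]
  | append_singleton es e ih =>
    have he := h e (by simp)
    have ih := ih fun e he => h e (by simp [he])
    simp only [labelList] at ih
    rw [labelList, List.foldl_append, ih, label_append]
    simp [List.getD_eq_getElem?_getD, he, relabel, Function.comp_def]

theorem getD_labelList {N : ℕ} {es : List (ℕ × ℕ)} (h : ∀ e ∈ es, e.1 < N ∧ e.2 < N) {i : ℕ}
    (hi : i < N) : (labelList N es).getD i 0 = label es i := by
  rw [labelList_eq h]
  simp [List.getD_eq_getElem?_getD, hi]

/-- Relabelling keeps the length of the list at `N` and only copies entries or inserts the default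
`0`, so all entries stay at most `N`. This bounds the intermediate values of the fold. -/
theorem poly_labelList {𝔸 : Ambient} {α : Type} [Enc α] {N : α → ℕ} {es : α → List (ℕ × ℕ)}
    (hN : PolyFun 𝔸 N) (hes : PolyFun 𝔸 es) : PolyFun 𝔸 fun a => labelList (N a) (es a) := by
  have b := hN.bounded
  refine PolyFun.foldl hes hN.range
    (f := fun _ L e => L.map fun l => if l = L.getD e.1 0 then L.getD e.2 0 else l)
    (PolyFun.map (l := fun x : α × (List ℕ × (ℕ × ℕ)) => x.2.1)
      (f := fun x l => if l = x.2.1.getD x.2.2.1 0 then x.2.1.getD x.2.2.2 0 else l)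
      (by fun_prop) (by fun_prop))
    ((b.mul (b.add (.const 1))).add (.const 1)) fun a k => ?_
  have key : ∀ es : List (ℕ × ℕ), (labelList (N a) es).length = N a ∧
      ∀ l ∈ labelList (N a) es, l ≤ N a := fun es => by
    induction es using List.reverseRecOn with
    | nil => simpa [labelList] using fun l hl => le_of_lt hl
    | append_singleton es e ih =>
      have e : labelList (N a) (es ++ [e]) = (labelList (N a) es).map fun l =>
          if l = (labelList (N a) es).getD e.1 0 then (labelList (N a) es).getD e.2 0 else l := by
        simp [labelList]
      refine ⟨by rw [e, List.length_map, ih.1], fun l hl => ?_⟩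
      rw [e] at hl
      obtain ⟨x, hx, rfl⟩ := List.mem_map.1 hl
      split_ifs
      · rw [List.getD_eq_getElem?_getD]
        rcases h : (labelList (N a) es)[_]? with _ | y
        · simp
        · exact ih.2 _ (List.mem_of_getElem? h)
      · exact ih.2 _ hx
  obtain ⟨h1, h2⟩ := key ((es a).take k)
  have h3 := sz_list_le (labelList (N a) ((es a).take k)) (sz (N a)) fun l hl => by
    have := h2 l hl
    simp only [sz_nat]
    omega
  refine h3.trans ?_
  rw [h1]
  gcongr
  rw [sz_nat]; omega

/-! ### Reading numbers in unary -/

section Runs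

variable {α : Type} (tick sep : α → Bool)

/-- The list of the numbers that are written in unary, each followed by a separator. -/
def runs (l : List α) : List ℕ :=
  l.foldr (fun a r => bif tick a then (r.headD 0 + 1) :: r.tail else bif sep a then 0 :: r else r) []

theorem runs_cons (a : α) (l : List α) : runs tick sep (a :: l) =
    bif tick a then ((runs tick sep l).headD 0 + 1) :: (runs tick sep l).tail
      else bif sep a then 0 :: runs tick sep l else runs tick sep l := rfl

theorem poly_runs {𝔸 : Ambient} [Enc α] (ht : PolyFun 𝔸 tick) (hs : PolyFun 𝔸 sep) :
    PolyFun 𝔸 fun l : List α => runs tick sep l := by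
  refine PolyFun.foldr (b := fun _ => []) (f := fun _ a r => bif tick a then (r.headD 0 + 1) :: r.tail
      else bif sep a then 0 :: r else r) PolyFun.id (PolyFun.const []) (by fun_prop)
    ((PolyBounded.const 4).mul .size) fun a t h => ?_
  -- The largest growth by one symbol is `4`: a tick before the empty list gives `[1]`, of size `5`
  -- instead of `1`.
  have : ∀ t : List α, sz (runs tick sep t) ≤ 4 * t.length + 1 := fun t => by
    induction t with
    | nil => simp [runs]
    | cons x t ih =>
      rw [runs_cons, List.length_cons]
      generalize runs tick sep t = r at ih
      cases tick x <;> cases sep x <;> cases r <;> simp [sz_nat] at ih ⊢ <;> omega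
  have h2 := h.length_le
  have h3 := length_lt_sz a
  exact (this t).trans (by omega)

theorem runs_append_of_false {l : List α} (h : ∀ a ∈ l, tick a = false ∧ sep a = false)
    (r : List α) : runs tick sep (l ++ r) = runs tick sep r := by
  induction l with
  | nil => rfl
  | cons a l ih =>
    have h1 := h a (by simp)
    rw [List.cons_append, runs_cons, h1.1, h1.2, ← ih fun a ha => h a (by simp [ha])]
    rfl

theorem runs_flatMap {t s : α} (ht : tick t = true) (hs : tick s = false) (hs' : sep s = true)
    (l : List ℕ) : runs tick sep (l.flatMap fun k => List.replicate k t ++ [s]) = l := by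
  induction l with
  | nil => rfl
  | cons k l ih =>
    rw [List.flatMap_cons, List.append_assoc]
    induction k with
    | zero => simpa [runs_cons, hs, hs'] using ih
    | succ k ihk =>
      rw [List.replicate_succ, List.cons_append, runs_cons, ht, ihk]
      rfl

end Runs

/-! ### Symbols and inputs -/

instance : Fintype Symbol where
  elems := {.breakable, .unbreakable, .tick, .sep}
  complete := by rintro ⟨⟩ <;> simp

/-- A number for each symbol. -/
def Symbol.code : Symbol → ℕ
  | breakable => 0
  | unbreakable => 1
  | tick => 2
  | sep => 3

theorem Symbol.code_injective : Function.Injective Symbol.code := by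
  rintro ⟨⟩ ⟨⟩ <;> simp [code]

instance : Enc Symbol where
  enc s := enc s.code

instance : Enc (Symbol ⊕ Bool) where
  enc x := enc (x.elim Symbol.code fun b => 4 + b.toNat)

theorem poly_symbol {𝔸 : Ambient} {β : Type} [Enc β] (f : Symbol → β) : PolyFun 𝔸 f :=
  .of_finite Symbol.code (fun _ => rfl) Symbol.code_injective f

theorem poly_symbol_sum {𝔸 : Ambient} {β : Type} [Enc β] (f : Symbol ⊕ Bool → β) : PolyFun 𝔸 f :=
  .of_finite (fun x : Symbol ⊕ Bool => x.elim Symbol.code fun b => 4 + b.toNat) (fun _ => rfl)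
    (by rintro (⟨⟨⟩⟩ | ⟨⟨⟩⟩) (⟨⟨⟩⟩ | ⟨⟨⟩⟩) <;> simp [Symbol.code]) f

theorem poly_bool {𝔸 : Ambient} {β : Type} [Enc β] (f : Bool → β) : PolyFun 𝔸 f :=
  .of_finite Bool.toNat (by rintro ⟨⟩ <;> rfl) (by rintro ⟨⟩ ⟨⟩ <;> simp) f

/-- The marks of the vertices and the list of the ends of the edges. -/
abbrev Data : Type := List Bool × List ℕ

/-- The data of an input. -/
def Input.data (I : Input) : Data :=
  (List.ofFn I.breakable, I.edges.flatMap fun e => [e.1, e.2])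

/-- The data written in a string. -/
def readData (x : List Symbol) : Data :=
  (x.flatMap (fun s => match s with | .breakable => [true] | .unbreakable => [false] | _ => []),
    runs (fun s => match s with | .tick => true | _ => false)
      (fun s => match s with | .sep => true | _ => false) x)

/-- The string in which data are written. -/
def writeData (d : Data) : List Symbol :=
  d.1.map (fun b => if b then Symbol.breakable else .unbreakable) ++ d.2.flatMap encodeIndex

theorem Input.encode_eq (I : Input) : I.encode = writeData I.data := by
  simp only [encode, writeData, data, List.map_ofFn, List.flatMap_assoc]
  congr 1
  · simp

theorem readData_writeData (d : Data) : readData (writeData d) = d := by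
  obtain ⟨mk, H⟩ := d
  simp only [readData, writeData]
  congr 1
  · rw [List.flatMap_append]
    have h1 : ∀ k, (encodeIndex k).flatMap (fun s => match s with
        | .breakable => [true] | .unbreakable => [false] | _ => []) = [] := fun k => by
      simp [encodeIndex]
    have h2 : ∀ mk : List Bool, (mk.map fun b => if b then Symbol.breakable else .unbreakable).flatMap
        (fun s => match s with
          | .breakable => [true] | .unbreakable => [false] | _ => []) = mk := fun mk => by
      induction mk with
      | nil => rfl
      | cons b mk ih => cases b <;> simp_all
    rw [h2, List.flatMap_assoc]
    simp only [h1]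
    simp
  · rw [runs_append_of_false]
    · exact runs_flatMap _ _ rfl rfl rfl H
    · intro a ha
      obtain ⟨b, -, rfl⟩ := List.mem_map.1 ha
      cases b <;> simp

/-- The data come from an input. -/
def Data.IsValid (d : Data) : Prop :=
  d.2.length / 2 + d.2.length / 2 = d.2.length ∧ ∀ v ∈ d.2, v < d.1.length

theorem Data.isValid_iff (d : Data) : d.IsValid ↔ ∃ I : Input, I.data = d := by
  obtain ⟨mk, H⟩ := d
  constructor
  · rintro ⟨h1, h2⟩
    simp only at h1 h2
    have : ∃ E : List (Fin mk.length × Fin mk.length),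
        (E.flatMap fun e => [(e.1 : ℕ), (e.2 : ℕ)]) = H := by
      induction hn : H.length / 2 generalizing H with
      | zero =>
        exact ⟨[], by simpa using (List.length_eq_zero_iff.1 (by omega)).symm⟩
      | succ k ih =>
        match H, h1, h2, hn with
        | a :: b :: H, h1, h2, hn =>
          simp only [List.length_cons] at h1 hn
          obtain ⟨E, hE⟩ := ih H (by omega) (fun v hv => h2 v (by simp [hv])) (by omega)
          exact ⟨(⟨a, h2 a (by simp)⟩, ⟨b, h2 b (by simp)⟩) :: E, by simp [hE]⟩
        | [a], h1, h2, hn => simp at hn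
        | [], h1, h2, hn => simp at hn
    obtain ⟨E, hE⟩ := this
    exact ⟨⟨mk.length, mk.get, E⟩, by simp [Input.data, hE]⟩
  · rintro ⟨I, h⟩
    simp only [Input.data, Prod.mk.injEq] at h
    obtain ⟨rfl, rfl⟩ := h
    refine ⟨?_, fun v hv => ?_⟩
    · simp [List.length_flatMap]; omega
    · simp only [List.mem_flatMap] at hv
      obtain ⟨e, -, he⟩ := hv
      simp only [List.mem_cons, List.not_mem_nil, or_false] at he
      rw [List.length_ofFn]
      rcases he with rfl | rfl
      exacts [e.1.2, e.2.2]

/-- `readData` accepts every string, including ill-formed ones. Writing the data again and comparing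
with `x` detects those. -/
theorem exists_eq_encode_iff (x : List Symbol) :
    (∃ I : Input, x = I.encode) ↔ (readData x).IsValid ∧ writeData (readData x) = x := by
  constructor
  · rintro ⟨I, rfl⟩
    rw [I.encode_eq, readData_writeData]
    exact ⟨(Data.isValid_iff _).2 ⟨I, rfl⟩, rfl⟩
  · rintro ⟨h, h'⟩
    obtain ⟨I, hI⟩ := (Data.isValid_iff _).1 h
    exact ⟨I, by rw [I.encode_eq, hI, h']⟩

theorem poly_readData {𝔸 : Ambient} : PolyFun 𝔸 readData := by
  have h : PolyFun 𝔸 fun x : List Symbol × Symbol => (match x.2 with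
      | .breakable => [true] | .unbreakable => [false] | _ => [] : List Bool) :=
    PolyFun.comp (poly_symbol fun s => match s with
      | .breakable => [true] | .unbreakable => [false] | _ => []) (by fun_prop)
  exact PolyFun.pair (PolyFun.flatMap PolyFun.id h)
    (poly_runs _ _ (poly_symbol _) (poly_symbol _))

theorem poly_writeData {𝔸 : Ambient} : PolyFun 𝔸 writeData := by
  have h : PolyFun 𝔸 encodeIndex := by
    have := PolyFun.append (PolyFun.map (f := fun _ _ => Symbol.tick) (PolyFun.range (𝔸 := 𝔸) PolyFun.id)
      (PolyFun.const _)) (PolyFun.const [Symbol.sep])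
    refine (congrArg (PolyFun 𝔸) (funext fun k => ?_)).mp this
    simp [encodeIndex]
  exact PolyFun.append (PolyFun.map (f := fun _ (b : Bool) => if b then Symbol.breakable else .unbreakable)
    (by fun_prop) (PolyFun.comp (poly_bool fun b : Bool => if b then Symbol.breakable else .unbreakable)
      (by fun_prop)))
    (PolyFun.flatMap (l := fun d : Data => d.2) (f := fun _ k => encodeIndex k) (by fun_prop) (by fun_prop))

theorem polyPred_exists_eq_encode {𝔸 : Ambient} :
    PolyPred 𝔸 fun x : List Symbol => ∃ I : Input, x = I.encode := by
  have h : PolyPred 𝔸 Data.IsValid := .and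
    (.eq (.add (.half (by fun_prop)) (.half (by fun_prop))) (by fun_prop))
    (.forall_mem (P := fun (d : Data) v => v < d.1.length) (by fun_prop) (.lt (by fun_prop) (by fun_prop)))
  exact ((h.comp poly_readData).and (.list_eq .sep (poly_writeData.comp poly_readData) PolyFun.id
    ((PolyPred.eq (.comp (poly_symbol Symbol.code) (by fun_prop))
      (.comp (poly_symbol Symbol.code) (by fun_prop))).congr fun x =>
        Symbol.code_injective.eq_iff))).congr fun x => (exists_eq_encode_iff x).symm

end TRVB

namespace TRVB

/-! ### Properties of inputs in terms of their data -/

/-- For turning cardinalities of sets of vertices or half-edges into counts over an initial segment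
of the numbers, which `PolyFun.card_filter` can compute. -/
theorem card_subtype_eq {α : Type} {g : α → ℕ} (hg : Function.Injective g) {N : ℕ}
    (hN : ∀ i, i < N ↔ ∃ a, g a = i) (P : ℕ → Prop) [DecidablePred P] :
    Nat.card {a // P (g a)} = ((Finset.range N).filter P).card := by
  rw [← Fintype.card_coe, ← Nat.card_eq_fintype_card]
  refine Nat.card_congr (Equiv.ofBijective
    (fun a => ⟨g a.1, by simpa using ⟨(hN _).2 ⟨_, rfl⟩, a.2⟩⟩) ⟨fun a b h => ?_, fun i => ?_⟩)
  · exact Subtype.ext (hg (by simpa using h))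
  · obtain ⟨i, hi⟩ := i
    simp only [Finset.mem_filter, Finset.mem_range] at hi
    obtain ⟨a, rfl⟩ := (hN i).1 hi.1
    exact ⟨⟨a, hi.2⟩, rfl⟩

theorem card_fin_eq (n : ℕ) (P : ℕ → Prop) [DecidablePred P] :
    Nat.card {v : Fin n // P v} = ((Finset.range n).filter P).card :=
  card_subtype_eq (g := fun v : Fin n => (v : ℕ)) Fin.val_injective
    (fun i => ⟨fun h => ⟨⟨i, h⟩, rfl⟩, by rintro ⟨a, rfl⟩; exact a.2⟩) P

theorem map_range_eq_ofFn {α : Type} (m : ℕ) (f : ℕ → α) :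
    (List.range m).map f = List.ofFn fun j : Fin m => f j :=
  List.ext_getElem (by simp) (by simp)

section HalfEdge

variable {m : ℕ}

/-- The position of a half-edge in the list of all half-edges. -/
def halfIdx (h : Fin m × Bool) : ℕ := h.1 + h.1 + h.2.toNat

theorem halfIdx_false (j : Fin m) : halfIdx (j, false) = j + j := rfl

theorem halfIdx_true (j : Fin m) : halfIdx (j, true) = j + j + 1 := rfl

theorem halfIdx_injective : Function.Injective (halfIdx (m := m)) := by
  rintro ⟨i, b⟩ ⟨j, c⟩ h
  simp only [halfIdx] at h
  cases b <;> cases c <;> simp at h ⊢ <;> omega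

theorem lt_iff_exists_halfIdx (i : ℕ) : i < m + m ↔ ∃ h : Fin m × Bool, halfIdx h = i := by
  constructor
  · intro h
    rcases Nat.mod_two_eq_zero_or_one i with h' | h'
    · exact ⟨(⟨i / 2, by omega⟩, false), by simp [halfIdx]; omega⟩
    · exact ⟨(⟨i / 2, by omega⟩, true), by simp [halfIdx]; omega⟩
  · rintro ⟨⟨j, b⟩, rfl⟩
    cases b <;> simp [halfIdx] <;> omega

theorem halfIdx_lt (h : Fin m × Bool) : halfIdx h < m + m := (lt_iff_exists_halfIdx _).2 ⟨h, rfl⟩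

theorem card_half_eq (P : ℕ → Prop) [DecidablePred P] :
    Nat.card {h : Fin m × Bool // P (halfIdx h)} = ((Finset.range (m + m)).filter P).card :=
  card_subtype_eq halfIdx_injective lt_iff_exists_halfIdx P

end HalfEdge

namespace Data

/-- The number of vertices. -/
def n (d : Data) : ℕ := d.1.length

/-- The number of edges. -/
def m (d : Data) : ℕ := d.2.length / 2

/-- The vertex to which a half-edge is attached. -/
def vert (d : Data) (i : ℕ) : ℕ := d.2.getD i 0

/-- The degree of a vertex. -/
def deg (d : Data) (v : ℕ) : ℕ := ((Finset.range (d.m + d.m)).filter fun i => d.vert i = v).card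

section Poly

variable {𝔸 : Ambient} {α : Type} [Enc α] {d : α → Data} {v : α → ℕ}

@[fun_prop]
theorem poly_n (hd : PolyFun 𝔸 d) : PolyFun 𝔸 fun a => (d a).n :=
  PolyFun.length (l := fun a => (d a).1) (by fun_prop)

@[fun_prop]
theorem poly_m (hd : PolyFun 𝔸 d) : PolyFun 𝔸 fun a => (d a).m :=
  PolyFun.half (n := fun a => (d a).2.length) (by fun_prop)

@[fun_prop]
theorem poly_vert (hd : PolyFun 𝔸 d) (hv : PolyFun 𝔸 v) : PolyFun 𝔸 fun a => (d a).vert (v a) :=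
  PolyFun.getD (l := fun a => (d a).2) (by fun_prop) hv 0

@[fun_prop]
theorem poly_deg (hd : PolyFun 𝔸 d) (hv : PolyFun 𝔸 v) : PolyFun 𝔸 fun a => (d a).deg (v a) :=
  PolyFun.card_filter (P := fun a i => (d a).vert i = v a) (by fun_prop)
    (.eq (by fun_prop) (by fun_prop))

end Poly

end Data

namespace Input

variable (I : Input)

theorem data_n : I.data.n = I.n := by simp [Data.n, data]

theorem length_data : I.data.2.length = I.edges.length + I.edges.length := by
  simp [data, List.length_flatMap]; omega

theorem data_m : I.data.m = I.edges.length := by rw [Data.m, length_data]; omega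

theorem data_fst (v : Fin I.n) : I.data.1.getD v false = I.breakable v := by
  simp [data, List.getD_eq_getElem?_getD]

theorem data_vert (h : Fin I.edges.length × Bool) :
    I.data.vert (halfIdx h) = I.graph.endpoint h := by
  have key : ∀ (E : List (Fin I.n × Fin I.n)) (j : ℕ) (hj : j < E.length),
      (E.flatMap fun e => [(e.1 : ℕ), (e.2 : ℕ)])[j + j]? = some (E[j].1 : ℕ) ∧
      (E.flatMap fun e => [(e.1 : ℕ), (e.2 : ℕ)])[j + j + 1]? = some (E[j].2 : ℕ) := by
    intro E
    induction E with
    | nil => simp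
    | cons e E ih =>
      rintro (_ | j) hj
      · simp
      · have := ih j (by simpa using hj)
        simpa [show j + 1 + (j + 1) = j + j + 1 + 1 by omega] using this
  obtain ⟨⟨j, hj⟩, b⟩ := h
  have := key I.edges j hj
  cases b
  · simp [Data.vert, data, halfIdx, List.getD_eq_getElem?_getD, this.1, graph]
  · simp [Data.vert, data, halfIdx, List.getD_eq_getElem?_getD, this.2, graph]

theorem degree_eq (v : Fin I.n) : I.graph.degree v = I.data.deg v := by
  rw [Data.deg, data_m, ← card_half_eq, Multigraph.degree]
  simp only [data_vert, Fin.val_inj]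

theorem noIsolatedVertices_iff : I.NoIsolatedVertices ↔ ∀ v < I.data.n, 0 < I.data.deg v := by
  rw [data_n]
  exact ⟨fun h v hv => by rw [← I.degree_eq ⟨v, hv⟩]; exact h _,
    fun h v => by rw [degree_eq]; exact h _ v.2⟩

theorem degreesIn_iff (B U : Set ℕ) : I.DegreesIn B U ↔ ∀ v < I.data.n,
    (I.data.1.getD v false = true → I.data.deg v ∈ B) ∧
      (¬ I.data.1.getD v false = true → I.data.deg v ∈ U) := by
  rw [data_n]
  have key : ∀ v : Fin I.n, (if I.breakable v then I.graph.degree v ∈ B else I.graph.degree v ∈ U) ↔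
      (I.data.1.getD v false = true → I.data.deg v ∈ B) ∧
      (¬ I.data.1.getD v false = true → I.data.deg v ∈ U) := fun v => by
    rw [data_fst, degree_eq]
    by_cases h : I.breakable v = true <;> simp [h]
  exact ⟨fun h v hv => (key ⟨v, hv⟩).1 (h _), fun h v => (key v).2 (h v v.2)⟩

theorem isLink_iff (j : Fin I.edges.length) (x y : Fin I.n) : I.graph.toGraph.IsLink j x y ↔
    (I.data.vert (j + j) = x ∧ I.data.vert (j + j + 1) = y) ∨
      (I.data.vert (j + j) = y ∧ I.data.vert (j + j + 1) = x) := by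
  rw [Multigraph.isLink_iff, ← halfIdx_true, ← halfIdx_false, data_vert, data_vert]
  simp only [Fin.val_inj]

theorem isSimple_iff : I.graph.IsSimple ↔ ∀ j < I.data.m,
    I.data.vert (j + j) ≠ I.data.vert (j + j + 1) ∧ ∀ k < I.data.m,
      ((I.data.vert (j + j) = I.data.vert (k + k) ∧
        I.data.vert (j + j + 1) = I.data.vert (k + k + 1)) ∨
      (I.data.vert (j + j) = I.data.vert (k + k + 1) ∧
        I.data.vert (j + j + 1) = I.data.vert (k + k))) → j = k := by
  rw [data_m]
  constructor
  · intro h j hj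
    have h : I.graph.toGraph.Simple := h
    have e1 := I.data_vert (⟨j, hj⟩, false)
    have e2 := I.data_vert (⟨j, hj⟩, true)
    rw [halfIdx_false] at e1
    rw [halfIdx_true] at e2
    refine ⟨fun h' => h.not_isLoopAt ⟨j, hj⟩ (I.graph.endpoint (⟨j, hj⟩, false)) ?_, ?_⟩
    · exact (I.isLink_iff _ _ _).2 (Or.inl ⟨e1, h'.symm.trans e1⟩)
    · intro k hk h'
      have := @h.eq_of_isLink ⟨k, hk⟩ ⟨j, hj⟩ (I.graph.endpoint (⟨j, hj⟩, false))
        (I.graph.endpoint (⟨j, hj⟩, true)) ((I.isLink_iff _ _ _).2 (by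
          simp only at *; omega)) ((I.isLink_iff _ _ _).2 (Or.inl ⟨e1, e2⟩))
      simpa using this.symm
  · intro h
    refine @Graph.Simple.mk _ _ _ ⟨fun e x hx => ?_⟩ fun e f x y he hf => ?_
    · refine (h e e.2).1 ?_
      rcases (I.isLink_iff _ _ _).1 hx with h | h <;> exact h.1.trans h.2.symm
    · refine Fin.ext ((h e e.2).2 f f.2 ?_)
      have he := (I.isLink_iff _ _ _).1 he
      have hf := (I.isLink_iff _ _ _).1 hf
      omega

end Input

/-! ### Trees -/

namespace Data

/-- The vertex to which a half-edge is attached when the vertices marked in `w` are broken. -/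
def brokenVert (d : Data) (w : List Bool) (i : ℕ) : ℕ :=
  if w.getD (d.vert i) false = true then d.n + i else d.vert i

/-- The labels of the vertices when the vertices marked in `w` are broken. -/
def brokenLabels (d : Data) (w : List Bool) : List ℕ :=
  labelList (d.n + (d.m + d.m))
    ((List.range d.m).map fun j => (d.brokenVert w (j + j), d.brokenVert w (j + j + 1)))

/-- Breaking the vertices marked in `w` leaves a tree. -/
def IsTree (d : Data) (w : List Bool) : Prop :=
  ((Finset.range d.n).filter fun v => ¬ w.getD v false = true ∧
      (d.brokenLabels w).getD v 0 = v).card +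
    ((Finset.range (d.m + d.m)).filter fun i => w.getD (d.vert i) false = true ∧
      (d.brokenLabels w).getD (d.n + i) 0 = d.n + i).card = 1 ∧
  ((Finset.range d.n).filter fun v => ¬ w.getD v false = true).card +
    ((Finset.range (d.m + d.m)).filter fun i => w.getD (d.vert i) false = true).card = d.m + 1

end Data

/-- The numbering `g` keeps the numbers of whole vertices and gives `n + i` to the new vertex at
half-edge `i`. Numbers of broken vertices, and those belonging to half-edges at whole vertices, are
not in its range and are excluded by the two filters. -/
theorem card_broken {n m : ℕ} {G : Multigraph (Fin n) (Fin m)} {S : Set (Fin n)} (w : List Bool)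
    (hS : ∀ v, v ∈ S ↔ w.getD v false = true) (vert : ℕ → ℕ)
    (hvert : ∀ h, vert (halfIdx h) = G.endpoint h)
    (g : {v : Fin n // v ∉ S} ⊕ {h : Fin m × Bool // G.endpoint h ∈ S} → ℕ)
    (hg : g = Sum.elim (fun v => (v.1 : ℕ)) fun h => n + halfIdx h.1) (P : ℕ → Prop)
    [DecidablePred P] :
    Nat.card {x // P (g x)} =
      ((Finset.range n).filter fun v => ¬ w.getD v false = true ∧ P v).card +
      ((Finset.range (m + m)).filter fun i => w.getD (vert i) false = true ∧ P (n + i)).card := by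
  subst hg
  rw [← card_fin_eq, ← card_half_eq, Nat.card_congr Equiv.subtypeSum, Nat.card_sum]
  simp only [hvert, ← hS, Sum.elim_inl, Sum.elim_inr]
  congr 1
  · exact Nat.card_congr (Equiv.subtypeSubtypeEquivSubtypeInter (fun v => v ∉ S) fun v => P v)
  · exact Nat.card_congr (Equiv.subtypeSubtypeEquivSubtypeInter
      (fun h : Fin m × Bool => G.endpoint h ∈ S) fun h => P (n + halfIdx h))

/-- Labels are computed for all numbers below `n + 2 * m`, whether or not they name vertices of the
broken graph. By `label_map` the labels of actual vertices are the right ones, and the counts ignore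
the other numbers. -/
theorem Input.isTree_iff (I : Input) (S : Set (Fin I.n)) (w : List Bool)
    (hS : ∀ v, v ∈ S ↔ w.getD v false = true) :
    (I.graph.breakVertices S).IsTree ↔ I.data.IsTree w := by
  classical
  set g : {v : Fin I.n // v ∉ S} ⊕ {h : Fin I.edges.length × Bool // I.graph.endpoint h ∈ S} → ℕ :=
    Sum.elim (fun v => (v.1 : ℕ)) fun h => I.n + halfIdx h.1 with hg
  have hginj : Function.Injective g := by
    rintro (a | a) (b | b) h
    · exact congrArg _ (Subtype.ext (Fin.ext h))
    · simp only [hg, Sum.elim_inl, Sum.elim_inr] at h; omega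
    · simp only [hg, Sum.elim_inl, Sum.elim_inr] at h; omega
    · simp only [hg, Sum.elim_inr, Nat.add_left_cancel_iff] at h
      exact congrArg _ (Subtype.ext (halfIdx_injective h))
  have hglt : ∀ x, g x < I.n + (I.edges.length + I.edges.length) := by
    rintro (a | a)
    · simp only [hg, Sum.elim_inl]; omega
    · simpa only [hg, Sum.elim_inr, Nat.add_lt_add_iff_left] using halfIdx_lt _
  have hend : ∀ h, I.data.brokenVert w (halfIdx h) =
      g ((I.graph.breakVertices S).endpoint h) := fun h => by
    simp only [Data.brokenVert, I.data_vert, data_n, ← hS, Multigraph.breakVertices]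
    split_ifs <;> rfl
  have hes : ((List.range I.data.m).map fun j => (I.data.brokenVert w (j + j),
      I.data.brokenVert w (j + j + 1))) =
      (I.graph.breakVertices S).ends.map (Prod.map g g) := by
    rw [data_m, Multigraph.ends, List.map_ofFn, map_range_eq_ofFn]
    exact congrArg _ (funext fun j => Prod.ext (hend (j, false)) (hend (j, true)))
  have hlab : ∀ x, (I.data.brokenLabels w).getD (g x) 0 =
      g (label (I.graph.breakVertices S).ends x) := fun x => by
    rw [Data.brokenLabels, data_n, hes, data_m, getD_labelList _ (hglt x), label_map hginj]
    intro e he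
    obtain ⟨e, -, rfl⟩ := List.mem_map.1 he
    exact ⟨hglt _, hglt _⟩
  rw [Multigraph.isTree_iff, Data.IsTree, data_n, data_m]
  have h1 := card_broken w hS I.data.vert I.data_vert g hg
    fun i => (I.data.brokenLabels w).getD i 0 = i
  -- With the trivial predicate this is the number of all vertices of the broken graph.
  have h2 := card_broken w hS I.data.vert I.data_vert g hg fun _ => True
  simp only [hlab, hginj.eq_iff] at h1
  simp only [and_true] at h2
  rw [← h1, ← h2]
  simp only [Nat.card_congr (Equiv.subtypeUnivEquiv fun _ => trivial)]

end TRVB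

namespace TRVB

/-! ### Planarity -/

/-- The labels of the cycles of a permutation of the half-edges, which is given by the images
`a j` and `b j` of the two halves of the edge `j`. -/
def cycleLabels (m : ℕ) (a b : ℕ → ℕ) : List ℕ :=
  labelList (m + m) (((List.range m).map fun j => (j + j, a j)) ++
    (List.range m).map fun j => (j + j + 1, b j))

section CycleLabels

variable {m : ℕ} {a b : ℕ → ℕ} {π : Equiv.Perm (Fin m × Bool)}

/-- The list of the pairs of a half-edge and its image. -/
def permPairs (π : Equiv.Perm (Fin m × Bool)) : List ((Fin m × Bool) × (Fin m × Bool)) :=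
  (List.ofFn fun j => ((j, false), π (j, false))) ++ List.ofFn fun j => ((j, true), π (j, true))

theorem label_permPairs_eq_iff (x y : Fin m × Bool) :
    label (permPairs π) x = label (permPairs π) y ↔ π.SameCycle x y := by
  refine label_eq_iff_sameCycle _ _ (fun x y => ?_) x y
  obtain ⟨j, c⟩ := x
  cases c <;> simp [permPairs, List.mem_ofFn, eq_comm]

theorem getD_cycleLabels (ha : ∀ j : Fin m, a j = halfIdx (π (j, false)))
    (hb : ∀ j : Fin m, b j = halfIdx (π (j, true))) (h : Fin m × Bool) :
    (cycleLabels m a b).getD (halfIdx h) 0 = halfIdx (label (permPairs π) h) := by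
  have hes : ((List.range m).map fun j => (j + j, a j)) ++
      ((List.range m).map fun j => (j + j + 1, b j)) =
      (permPairs π).map (Prod.map halfIdx halfIdx) := by
    rw [permPairs, List.map_append, List.map_ofFn, List.map_ofFn, map_range_eq_ofFn,
      map_range_eq_ofFn]
    congr 2
    · exact funext fun j => Prod.ext rfl (ha j)
    · exact funext fun j => Prod.ext rfl (hb j)
  rw [cycleLabels, hes, getD_labelList _ (halfIdx_lt h), label_map halfIdx_injective]
  intro e he
  obtain ⟨e, -, rfl⟩ := List.mem_map.1 he
  exact ⟨halfIdx_lt _, halfIdx_lt _⟩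

theorem getD_cycleLabels_eq_iff (ha : ∀ j : Fin m, a j = halfIdx (π (j, false)))
    (hb : ∀ j : Fin m, b j = halfIdx (π (j, true))) (x y : Fin m × Bool) :
    (cycleLabels m a b).getD (halfIdx x) 0 = (cycleLabels m a b).getD (halfIdx y) 0 ↔
      π.SameCycle x y := by
  rw [getD_cycleLabels ha hb, getD_cycleLabels ha hb, halfIdx_injective.eq_iff,
    label_permPairs_eq_iff]

theorem card_cycleLabels (ha : ∀ j : Fin m, a j = halfIdx (π (j, false)))
    (hb : ∀ j : Fin m, b j = halfIdx (π (j, true))) :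
    Nat.card (Quotient (Equiv.Perm.SameCycle.setoid π)) =
      ((Finset.range (m + m)).filter fun i => (cycleLabels m a b).getD i 0 = i).card := by
  rw [← card_half_eq]
  simp only [getD_cycleLabels ha hb, halfIdx_injective.eq_iff]
  refine card_quot_eq _ fun x y => ?_
  rw [label_permPairs_eq_iff]
  exact Quotient.eq (r := Equiv.Perm.SameCycle.setoid π)

end CycleLabels

namespace Data

/-- The labels of the components. -/
def compLabels (d : Data) : List ℕ :=
  labelList d.n ((List.range d.m).map fun j => (d.vert (j + j), d.vert (j + j + 1)))

/-- The permutation `s` of the half-edges is a rotation system that satisfies Euler's formula. -/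
def IsPlanarRotation (d : Data) (s : ℕ → ℕ) : Prop :=
  (∀ i < d.m + d.m, ∀ j < d.m + d.m,
    ((cycleLabels d.m (fun j => s (j + j)) fun j => s (j + j + 1)).getD i 0 =
      (cycleLabels d.m (fun j => s (j + j)) fun j => s (j + j + 1)).getD j 0 ↔
      d.vert i = d.vert j)) ∧
  d.n + ((Finset.range (d.m + d.m)).filter fun i =>
      (cycleLabels d.m (fun j => s (j + j + 1)) fun j => s (j + j)).getD i 0 = i).card =
    d.m + 2 * ((Finset.range d.n).filter fun v => d.compLabels.getD v 0 = v).card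

/-- The list `t` describes a planar embedding. -/
def IsPlanar (d : Data) (t : List ℕ) : Prop :=
  (∀ i < d.m + d.m, t.getD i 0 < d.m + d.m ∧ ∀ j < d.m + d.m, t.getD i 0 = t.getD j 0 → i = j) ∧
    d.IsPlanarRotation fun i => t.getD i 0

end Data

namespace Input

variable {I : Input}

theorem componentCount_eq : I.graph.componentCount =
    ((Finset.range I.data.n).filter fun v => I.data.compLabels.getD v 0 = v).card := by
  have hes : ((List.range I.data.m).map fun j => (I.data.vert (j + j), I.data.vert (j + j + 1))) =
      I.graph.ends.map (Prod.map Fin.val Fin.val) := by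
    rw [data_m, Multigraph.ends, List.map_ofFn, map_range_eq_ofFn]
    exact congrArg _ (funext fun j => Prod.ext (I.data_vert (j, false)) (I.data_vert (j, true)))
  have hlab : ∀ v : Fin I.n, I.data.compLabels.getD v 0 = label I.graph.ends v := fun v => by
    rw [Data.compLabels, data_n, hes, getD_labelList _ v.2, label_map Fin.val_injective]
    intro e he
    obtain ⟨e, -, rfl⟩ := List.mem_map.1 he
    exact ⟨Fin.is_lt _, Fin.is_lt _⟩
  rw [Multigraph.componentCount_eq, data_n, ← card_fin_eq]
  simp only [hlab, Fin.val_inj]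

theorem isPlanarRotation_iff (hI : I.NoIsolatedVertices)
    {σ : Equiv.Perm (Fin I.edges.length × Bool)} {s : ℕ → ℕ}
    (hs : ∀ h, s (halfIdx h) = halfIdx (σ h)) :
    I.data.IsPlanarRotation s ↔ I.graph.IsRotationSystem σ ∧
      Nat.card (Fin I.n) + I.graph.faceCount σ =
        Nat.card (Fin I.edges.length) + 2 * I.graph.componentCount := by
  have h0 : Nat.card {v : Fin I.n // ∀ h, I.graph.endpoint h ≠ v} = 0 := by
    -- The faces around isolated vertices drop out of the count.
    have : IsEmpty {v : Fin I.n // ∀ h, I.graph.endpoint h ≠ v} := ⟨fun ⟨v, hv⟩ => by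
      have h := hI v
      rw [Multigraph.degree, Nat.card_pos_iff] at h
      obtain ⟨⟨⟨h, e⟩⟩, -⟩ := h
      exact hv h e⟩
    exact Nat.card_of_isEmpty
  -- Faces are the cycles of `σ * flip`, and composing with the flip exchanges the images of the two
  -- halves of each edge. Hence the roles of `j + j` and `j + j + 1` are interchanged.
  rw [Data.IsPlanarRotation, Multigraph.faceCount, h0, componentCount_eq, data_m, data_n,
    ← card_cycleLabels (π := σ * Multigraph.flip (Fin I.edges.length)) (a := fun j => s (j + j + 1))
      (b := fun j => s (j + j)) (fun j => hs (j, true)) (fun j => hs (j, false))]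
  simp only [Nat.card_eq_fintype_card, Fintype.card_fin, add_zero]
  refine and_congr_left' ?_
  have key := getD_cycleLabels_eq_iff (π := σ) (a := fun j => s (j + j))
    (b := fun j => s (j + j + 1)) (fun j => hs (j, false)) fun j => hs (j, true)
  constructor
  · intro h x y
    rw [← key, h _ (halfIdx_lt x) _ (halfIdx_lt y), I.data_vert, I.data_vert, Fin.val_inj]
  · intro h i hi j hj
    obtain ⟨x, rfl⟩ := (lt_iff_exists_halfIdx i).1 hi
    obtain ⟨y, rfl⟩ := (lt_iff_exists_halfIdx j).1 hj
    rw [key, h, I.data_vert, I.data_vert, Fin.val_inj]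

/-- The half-edges in their order. -/
noncomputable def halfEquiv (m : ℕ) : Fin m × Bool ≃ Fin (m + m) :=
  Equiv.ofBijective (fun h => ⟨halfIdx h, halfIdx_lt h⟩)
    ⟨fun x y h => halfIdx_injective (by simpa using h), fun ⟨i, hi⟩ => by
      obtain ⟨h, rfl⟩ := (lt_iff_exists_halfIdx i).1 hi
      exact ⟨h, rfl⟩⟩

theorem halfIdx_halfEquiv_symm {m : ℕ} (i : Fin (m + m)) :
    halfIdx ((halfEquiv m).symm i) = i :=
  congrArg Fin.val ((halfEquiv m).apply_symm_apply i)

/-- The table is arbitrary, so it must first be seen to be a permutation: an injective map of a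
finite set to itself is one. -/
theorem isPlanar_of_data (hI : I.NoIsolatedVertices) {t : List ℕ} (h : I.data.IsPlanar t) :
    I.graph.IsPlanar := by
  obtain ⟨h1, h2⟩ := h
  rw [data_m] at h1
  let f : Fin I.edges.length × Bool → Fin I.edges.length × Bool := fun x =>
    (halfEquiv _).symm ⟨t.getD (halfIdx x) 0, (h1 _ (halfIdx_lt x)).1⟩
  have hf : ∀ x, t.getD (halfIdx x) 0 = halfIdx (f x) := fun x =>
    (halfIdx_halfEquiv_symm ⟨t.getD (halfIdx x) 0, (h1 _ (halfIdx_lt x)).1⟩).symm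
  have hinj : Function.Injective f := fun x y h => halfIdx_injective
    ((h1 _ (halfIdx_lt x)).2 _ (halfIdx_lt y) (by rw [hf, hf, h]))
  exact ⟨Equiv.ofBijective f (Finite.injective_iff_bijective.1 hinj),
    (isPlanarRotation_iff hI hf).1 h2⟩

theorem exists_data_isPlanar (hI : I.NoIsolatedVertices) (h : I.graph.IsPlanar) :
    ∃ t : List ℕ, t.length = I.data.2.length ∧ (∀ x ∈ t, x < I.data.2.length) ∧
      I.data.IsPlanar t := by
  obtain ⟨σ, h⟩ := h
  set t : List ℕ := List.ofFn fun i => halfIdx (σ ((halfEquiv _).symm i)) with ht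
  have hs : ∀ x, t.getD (halfIdx x) 0 = halfIdx (σ x) := fun x => by
    rw [ht, List.getD_eq_getElem _ _ (by simpa using halfIdx_lt x), List.getElem_ofFn]
    exact congrArg (fun x => halfIdx (σ x)) ((halfEquiv _).symm_apply_apply x)
  refine ⟨t, by rw [length_data, ht, List.length_ofFn], fun x hx => ?_, fun i hi => ?_,
    (isPlanarRotation_iff hI hs).2 h⟩
  · obtain ⟨i, rfl⟩ := (List.mem_ofFn' _ _).1 hx
    rw [length_data]
    exact halfIdx_lt _
  · rw [data_m] at hi ⊢
    obtain ⟨x, rfl⟩ := (lt_iff_exists_halfIdx i).1 hi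
    refine ⟨by rw [hs]; exact halfIdx_lt _, fun j hj h => ?_⟩
    obtain ⟨y, rfl⟩ := (lt_iff_exists_halfIdx j).1 hj
    rw [hs, hs, halfIdx_injective.eq_iff, σ.injective.eq_iff] at h
    rw [h]

end Input

/-! ### Decidability in polynomial time -/

namespace Data

variable {𝔸 : Ambient} {α : Type} [Enc α] {d : α → Data} {w : α → List Bool} {t : α → List ℕ}
  {i : α → ℕ}

@[fun_prop]
theorem poly_brokenVert (hd : PolyFun 𝔸 d) (hw : PolyFun 𝔸 w) (hi : PolyFun 𝔸 i) :
    PolyFun 𝔸 fun a => (d a).brokenVert (w a) (i a) :=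
  PolyFun.ite (.of_bool (by fun_prop)) (by fun_prop) (by fun_prop)

@[fun_prop]
theorem poly_brokenLabels (hd : PolyFun 𝔸 d) (hw : PolyFun 𝔸 w) :
    PolyFun 𝔸 fun a => (d a).brokenLabels (w a) :=
  poly_labelList (by fun_prop) (PolyFun.map
    (f := fun a j => ((d a).brokenVert (w a) (j + j), (d a).brokenVert (w a) (j + j + 1)))
    (by fun_prop) (by fun_prop))

@[fun_prop]
theorem poly_compLabels (hd : PolyFun 𝔸 d) : PolyFun 𝔸 fun a => (d a).compLabels :=
  poly_labelList (by fun_prop) (PolyFun.map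
    (f := fun a j => ((d a).vert (j + j), (d a).vert (j + j + 1))) (by fun_prop) (by fun_prop))

theorem poly_cycleLabels {m : α → ℕ} {a b : α → ℕ → ℕ} (hm : PolyFun 𝔸 m)
    (ha : PolyFun 𝔸 fun x : α × ℕ => a x.1 x.2) (hb : PolyFun 𝔸 fun x : α × ℕ => b x.1 x.2) :
    PolyFun 𝔸 fun x => cycleLabels (m x) (a x) (b x) :=
  poly_labelList (by fun_prop) (PolyFun.append
    (PolyFun.map (f := fun x j => (j + j, a x j)) (by fun_prop) (by fun_prop))
    (PolyFun.map (f := fun x j => (j + j + 1, b x j)) (by fun_prop) (by fun_prop)))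

theorem polyPred_isTree (hd : PolyFun 𝔸 d) (hw : PolyFun 𝔸 w) :
    PolyPred 𝔸 fun a => (d a).IsTree (w a) := by
  refine .and (.eq (.add (.card_filter (by fun_prop) (.and (.not (.of_bool ?_)) (.eq ?_ ?_)))
    (.card_filter (by fun_prop) (.and (.of_bool ?_) (.eq ?_ ?_)))) (by fun_prop))
    (.eq (.add (.card_filter (by fun_prop) (.not (.of_bool ?_)))
      (.card_filter (by fun_prop) (.of_bool ?_))) (by fun_prop)) <;> fun_prop

theorem polyPred_isPlanar (hd : PolyFun 𝔸 d) (ht : PolyFun 𝔸 t) :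
    PolyPred 𝔸 fun a => (d a).IsPlanar (t a) := by
  have hrot : PolyFun 𝔸 fun a => cycleLabels (d a).m (fun j => (t a).getD (j + j) 0)
      fun j => (t a).getD (j + j + 1) 0 :=
    poly_cycleLabels (by fun_prop) (by fun_prop) (by fun_prop)
  have hface : PolyFun 𝔸 fun a => cycleLabels (d a).m (fun j => (t a).getD (j + j + 1) 0)
      fun j => (t a).getD (j + j) 0 :=
    poly_cycleLabels (by fun_prop) (by fun_prop) (by fun_prop)
  refine .and (.forall_lt (by fun_prop) (.and (.lt (by fun_prop) (by fun_prop))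
    (.forall_lt (by fun_prop) (.imp (.eq (by fun_prop) (by fun_prop))
      (.eq (by fun_prop) (by fun_prop))))))
    (.and (.forall_lt (by fun_prop) (.forall_lt (by fun_prop) (.iff (.eq ?_ ?_)
      (.eq (by fun_prop) (by fun_prop)))))
      (.eq (.add (by fun_prop) (.card_filter (by fun_prop) (.eq ?_ (by fun_prop)))) ?_))
  · exact PolyFun.getD (hrot.comp (by fun_prop)) (by fun_prop) 0
  · exact PolyFun.getD (hrot.comp (by fun_prop)) (by fun_prop) 0
  · exact PolyFun.getD (hface.comp (by fun_prop)) (by fun_prop) 0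
  · simp only [two_mul]
    have : PolyFun 𝔸 fun a => ((Finset.range (d a).n).filter fun v =>
        (d a).compLabels.getD v 0 = v).card :=
      .card_filter (by fun_prop) (.eq (by fun_prop) (by fun_prop))
    fun_prop

theorem polyPred_noIsolated (hd : PolyFun 𝔸 d) :
    PolyPred 𝔸 fun a => ∀ v < (d a).n, 0 < (d a).deg v :=
  .forall_lt (by fun_prop) (.lt (by fun_prop) (by fun_prop))

theorem polyPred_isSimple (hd : PolyFun 𝔸 d) : PolyPred 𝔸 fun a => ∀ j < (d a).m,
    (d a).vert (j + j) ≠ (d a).vert (j + j + 1) ∧ ∀ k < (d a).m,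
      (((d a).vert (j + j) = (d a).vert (k + k) ∧
        (d a).vert (j + j + 1) = (d a).vert (k + k + 1)) ∨
      ((d a).vert (j + j) = (d a).vert (k + k + 1) ∧
        (d a).vert (j + j + 1) = (d a).vert (k + k))) → j = k := by
  refine .forall_lt (by fun_prop) (.and (.not (.eq ?_ ?_)) (.forall_lt (by fun_prop)
    (.imp (.or (.and (.eq ?_ ?_) (.eq ?_ ?_)) (.and (.eq ?_ ?_) (.eq ?_ ?_)))
      (.eq ?_ ?_)))) <;> fun_prop

theorem polyPred_degreesIn {B U : Set ℕ} (hB : PolyPred 𝔸 fun k => k ∈ B)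
    (hU : PolyPred 𝔸 fun k => k ∈ U) (hd : PolyFun 𝔸 d) : PolyPred 𝔸 fun a => ∀ v < (d a).n,
    ((d a).1.getD v false = true → (d a).deg v ∈ B) ∧
      (¬ (d a).1.getD v false = true → (d a).deg v ∈ U) := by
  have h : PolyFun 𝔸 fun x : α × ℕ => (d x.1).deg x.2 := by fun_prop
  have h' : PolyPred 𝔸 fun x : α × ℕ => (d x.1).1.getD x.2 false = true :=
    .of_bool (by fun_prop)
  exact .forall_lt (by fun_prop) (.and (.imp h' (hB.comp h)) (.imp h'.not (hU.comp h)))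

end Data

end TRVB

namespace TRVB

/-! ### From predicates to machines -/

/-- The machines on inputs and certificates, with a finite family of subroutines. -/
abbrev ambient {ι : Type} [DecidableEq ι] [Fintype ι] (f : ι → ℕ → Bool)
    (comp : ∀ i, Turing.TM2ComputableInPolyTime Computability.unaryEncodingNat.encode
      Computability.encodeBool (f i)) : Ambient where
  A := Symbol ⊕ Bool
  ι := ι
  f := f
  comp := comp

section

variable {ι : Type} [DecidableEq ι] [Fintype ι] {f : ι → ℕ → Bool}
  {comp : ∀ i, Turing.TM2ComputableInPolyTime Computability.unaryEncodingNat.encode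
    Computability.encodeBool (f i)}

/-- The machine receives one string over the sum of the alphabets; keeping the symbols of either
kind recovers the two components. The reversal makes up for the order in which the input is read. -/
theorem polyTimeDecidable_of_polyPred {P : List Symbol × List Bool → Prop}
    (h : PolyPred (ambient f comp) P) : PolyTimeDecidable (pairEncoding Symbol) P := by
  let left : Symbol ⊕ Bool → List Symbol := fun s => s.elim (fun s => [s]) fun _ => []
  let right : Symbol ⊕ Bool → List Bool := fun s => s.elim (fun _ => []) fun b => [b]
  obtain ⟨g, hg, hP⟩ := h
  have hl : PolyFun (ambient f comp) fun x : List (Symbol ⊕ Bool) × (Symbol ⊕ Bool) => left x.2 :=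
    .comp (poly_symbol_sum left) (by fun_prop)
  have hr : PolyFun (ambient f comp) fun x : List (Symbol ⊕ Bool) × (Symbol ⊕ Bool) => right x.2 :=
    .comp (poly_symbol_sum right) (by fun_prop)
  have hG : PolyFun (ambient f comp) fun l : List (Symbol ⊕ Bool) =>
      g (l.flatMap left, l.flatMap right) :=
    hg.comp (.pair (.flatMap .id hl) (.flatMap .id hr))
  have := PolyFun.tm2 (𝔸 := ambient f comp) (f := fun l : List (Symbol ⊕ Bool) =>
    g (l.flatMap left, l.flatMap right)) (hG.comp (.reverse .id)) (pairEncoding Symbol).encode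
  refine ⟨_, fun a => ?_, this⟩
  rw [hP]
  have e1 : ((pairEncoding Symbol).encode a).flatMap left = a.1 := by
    simp [pairEncoding, Computability.encodingProd, Computability.encodingList, left,
      List.flatMap_map]
  have e2 : ((pairEncoding Symbol).encode a).flatMap right = a.2 := by
    simp [pairEncoding, Computability.encodingProd, Computability.encodingList, right,
      List.flatMap_map]
  rw [e1, e2]

end

/-! ### Certificates and membership in NP -/

/-- The vertices marked in `w` are breakable, and breaking them leaves a tree. -/
def Data.IsSolution (d : Data) (w : List Bool) : Prop :=
  (∀ v < d.n, w.getD v false = true → d.1.getD v false = true) ∧ d.IsTree w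

theorem Data.polyPred_isSolution {𝔸 : Ambient} {α : Type} [Enc α] {d : α → Data}
    {w : α → List Bool} (hd : PolyFun 𝔸 d) (hw : PolyFun 𝔸 w) :
    PolyPred 𝔸 fun a => (d a).IsSolution (w a) :=
  .and (.forall_lt (by fun_prop) (.imp (.of_bool (by fun_prop)) (.of_bool (by fun_prop))))
    (polyPred_isTree hd hw)

theorem Input.isSolution_iff (I : Input) (S : Finset (Fin I.n)) (w : List Bool)
    (hS : ∀ v, v ∈ S ↔ w.getD v false = true) : I.IsSolution S ↔ I.data.IsSolution w := by
  refine and_congr ?_ (I.isTree_iff S w (by simpa using hS))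
  rw [data_n]
  refine ⟨fun h v hv hw => ?_, fun h v hv => ?_⟩
  · rw [I.data_fst ⟨v, hv⟩]
    exact h _ ((hS ⟨v, hv⟩).2 hw)
  · rw [← I.data_fst]
    exact h v v.2 ((hS v).1 hv)

theorem getD_encodeVertexSet {n : ℕ} (S : Finset (Fin n)) (r : List Bool) (v : Fin n) :
    v ∈ S ↔ (encodeVertexSet S ++ r).getD v false = true := by
  have h : (v : ℕ) < (List.ofFn fun v => decide (v ∈ S)).length := by simp
  rw [encodeVertexSet, List.getD_append _ _ _ _ h, List.getD_eq_getElem _ _ h]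
  simp

/-- The condition on the length makes `w` equal to the characteristic string of the set it marks;
the rest would also hold for longer strings, or shorter ones read with default `false`. -/
theorem isCertificate_iff (x : List Symbol) (w : List Bool) : IsCertificate x w ↔
    (∃ I : Input, x = I.encode) ∧ w.length = (readData x).n ∧
      (∀ v < (readData x).n, 0 < (readData x).deg v) ∧ (readData x).IsSolution w := by
  constructor
  · rintro ⟨I, S, rfl, rfl, h1, h2⟩
    rw [I.encode_eq, readData_writeData]
    refine ⟨⟨I, I.encode_eq.symm⟩, by simp [encodeVertexSet, I.data_n],
      I.noIsolatedVertices_iff.1 h1, (I.isSolution_iff S _ fun v => ?_).1 h2⟩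
    simpa using getD_encodeVertexSet S [] v
  · rintro ⟨⟨I, rfl⟩, h1, h2, h3⟩
    rw [I.encode_eq, readData_writeData] at h1 h2 h3
    rw [I.data_n] at h1
    refine ⟨I, Finset.univ.filter fun v => w.getD v false = true, rfl, ?_,
      I.noIsolatedVertices_iff.2 h2, (I.isSolution_iff _ w fun v => by simp).2 h3⟩
    refine List.ext_getElem (by simp [encodeVertexSet, h1]) fun i hi hi' => ?_
    simp [encodeVertexSet, List.getD_eq_getElem?_getD, hi]

theorem polyPred_isCertificate {𝔸 : Ambient} :
    PolyPred 𝔸 fun z : List Symbol × List Bool => IsCertificate z.1 z.2 := by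
  have h : PolyFun 𝔸 fun z : List Symbol × List Bool => readData z.1 :=
    poly_readData.comp (by fun_prop)
  exact ((polyPred_exists_eq_encode.comp (f := fun z : List Symbol × List Bool => z.1)
    (by fun_prop)).and ((PolyPred.eq (by fun_prop) (Data.poly_n h)).and
      ((Data.polyPred_noIsolated h).and (Data.polyPred_isSolution h (by fun_prop))))).congr
    fun z => (isCertificate_iff z.1 z.2).symm

/-- The constraint `C` is witnessed by a list of small numbers that can be checked in polynomial
time. -/
def HasWitness (𝔸 : Ambient) (C : Input → Prop) : Prop :=
  ∃ Q : Data → List ℕ → Prop, (PolyPred 𝔸 fun x : Data × List ℕ => Q x.1 x.2) ∧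
    ∀ I : Input, I.NoIsolatedVertices →
      (C I → ∃ t : List ℕ, t.length ≤ I.data.2.length ∧ (∀ k ∈ t, k ≤ I.data.2.length) ∧
        Q I.data t) ∧ ∀ t, Q I.data t → C I

theorem HasWitness.of_iff {𝔸 : Ambient} {C : Input → Prop} {Q : Data → Prop}
    (hQ : PolyPred 𝔸 Q) (h : ∀ I : Input, C I ↔ Q I.data) : HasWitness 𝔸 C :=
  ⟨fun d _ => Q d, hQ.comp (by fun_prop), fun I _ =>
    ⟨fun hC => ⟨[], by simp, by simp, (h I).1 hC⟩, fun _ hQ => (h I).2 hQ⟩⟩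

theorem HasWitness.and {𝔸 : Ambient} {C C' : Input → Prop} {Q : Data → Prop}
    (hQ : PolyPred 𝔸 Q) (h : ∀ I : Input, C I ↔ Q I.data) (h' : HasWitness 𝔸 C') :
    HasWitness 𝔸 fun I => C I ∧ C' I := by
  obtain ⟨Q', hQ', H⟩ := h'
  refine ⟨fun d t => Q d ∧ Q' d t, (hQ.comp (by fun_prop)).and hQ', fun I hI =>
    ⟨fun ⟨hC, hC'⟩ => ?_, fun t ht => ⟨(h I).2 ht.1, (H I hI).2 t ht.2⟩⟩⟩
  obtain ⟨t, h1, h2, h3⟩ := (H I hI).1 hC'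
  exact ⟨t, h1, h2, (h I).1 hC, h3⟩

theorem hasWitness_isPlanar {𝔸 : Ambient} : HasWitness 𝔸 fun I => I.graph.IsPlanar := by
  refine ⟨Data.IsPlanar, Data.polyPred_isPlanar (by fun_prop) (by fun_prop), fun I hI =>
    ⟨fun h => ?_, fun t ht => Input.isPlanar_of_data hI ht⟩⟩
  obtain ⟨t, h1, h2, h3⟩ := Input.exists_data_isPlanar hI h
  exact ⟨t, h1.le, fun k hk => (h2 k hk).le, h3⟩

/-- Numbers read from a bit string. -/
def readNumbers (w : List Bool) : List ℕ := runs (fun b => b) (fun b => !b) w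

theorem poly_readNumbers {𝔸 : Ambient} : PolyFun 𝔸 readNumbers :=
  poly_runs _ _ (poly_bool _) (poly_bool _)

/-- Numbers written in a bit string. -/
def writeNumbers (t : List ℕ) : List Bool := t.flatMap fun k => List.replicate k true ++ [false]

theorem readNumbers_writeNumbers (t : List ℕ) : readNumbers (writeNumbers t) = t :=
  runs_flatMap _ _ rfl rfl rfl t

theorem length_writeNumbers_le {t : List ℕ} {N : ℕ} (h : ∀ k ∈ t, k ≤ N) :
    (writeNumbers t).length ≤ t.length * (N + 1) := by
  induction t with
  | nil => simp [writeNumbers]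
  | cons k t ih =>
    have h1 := ih fun k hk => h k (by simp [hk])
    have h2 := h k (by simp)
    simp only [writeNumbers] at h1
    simp only [writeNumbers, List.flatMap_cons, List.length_append, List.length_replicate,
      List.length_nil, List.length_cons, Nat.add_mul] at h1 ⊢
    omega

theorem length_data_le (I : Input) : I.n + I.data.2.length ≤ I.encode.length := by
  have : ∀ l : List ℕ, l.length ≤ (l.flatMap encodeIndex).length := fun l => by
    induction l with
    | nil => simp
    | cons k l ih => simp [encodeIndex] at ih ⊢; omega
  have h := this I.data.2
  rw [I.encode_eq, writeData, List.length_append, List.length_map]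
  have h' := I.data_n
  rw [Data.n] at h'
  omega

section

variable {ι : Type} [DecidableEq ι] [Fintype ι] {f : ι → ℕ → Bool}
  {comp : ∀ i, Turing.TM2ComputableInPolyTime Computability.unaryEncodingNat.encode
    Computability.encodeBool (f i)}

/-- The certificate is the characteristic string of `S` followed by the witness for `C` in unary,
split after `n` bits. The checker need not insist on a well-formed string, because any accepted
string marks a solution and contains numbers that prove `C`. -/
theorem inNP_restrictedTRVB {C : Input → Prop} (h : HasWitness (ambient f comp) C) :
    InNP (restrictedTRVB C) := by
  obtain ⟨Q, hQ, H⟩ := h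
  -- With `X` the length of `x`, there are at most `X` marks, then at most `X` numbers of at most
  -- `X` ticks and a separator each.
  refine ⟨.X + .X * (.X + 1), fun x w => (∃ I : Input, x = I.encode) ∧
    (∀ v < (readData x).n, 0 < (readData x).deg v) ∧ (readData x).IsSolution w ∧
      Q (readData x) (readNumbers (w.drop (readData x).n)),
    polyTimeDecidable_of_polyPred (f := f) (comp := comp) ?_, fun x => ⟨?_, ?_⟩⟩
  · have h : PolyFun (ambient f comp) fun z : List Symbol × List Bool => readData z.1 :=
      poly_readData.comp (by fun_prop)
    exact (polyPred_exists_eq_encode.comp (f := fun z : List Symbol × List Bool => z.1)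
      (by fun_prop)).and ((Data.polyPred_noIsolated h).and
        ((Data.polyPred_isSolution h (by fun_prop)).and (hQ.comp (f := fun z : List Symbol × List Bool =>
          (readData z.1, readNumbers (z.2.drop (readData z.1).n)))
          (h.pair (poly_readNumbers.comp (.drop (Data.poly_n h) (by fun_prop)))))))
  · rintro ⟨I, rfl, hI, hC, S, hS⟩
    obtain ⟨t, h1, h2, h3⟩ := (H I hI).1 hC
    have hlen : (encodeVertexSet S).length = I.n := by simp [encodeVertexSet]
    refine ⟨encodeVertexSet S ++ writeNumbers t, ?_, ⟨I, rfl⟩, ?_⟩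
    · have h4 := length_data_le I
      have h5 := length_writeNumbers_le h2
      have h6 : t.length * (I.data.2.length + 1) ≤ I.encode.length * (I.encode.length + 1) := by
        gcongr <;> omega
      simp only [List.length_append, hlen, Polynomial.eval_add, Polynomial.eval_mul,
        Polynomial.eval_X, Polynomial.eval_one]
      omega
    · rw [I.encode_eq, readData_writeData]
      refine ⟨I.noIsolatedVertices_iff.1 hI,
        (I.isSolution_iff S _ fun v => getD_encodeVertexSet S _ v).1 hS, ?_⟩
      rwa [I.data_n, List.drop_left' hlen, readNumbers_writeNumbers]
  · rintro ⟨w, -, ⟨I, rfl⟩, h1, h2, h3⟩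
    rw [I.encode_eq, readData_writeData] at h1 h2 h3
    have hI := I.noIsolatedVertices_iff.2 h1
    exact ⟨I, rfl, hI, (H I hI).2 _ h3, Finset.univ.filter fun v => w.getD v false = true,
      (I.isSolution_iff _ w fun v => by simp).2 h2⟩

end

theorem inNP_trvb : InNP trvb :=
  inNP_restrictedTRVB (f := fun i : Empty => i.elim) (comp := fun i => i.elim)
    (.of_iff (Q := fun _ => True) (.const True) fun _ => Iff.rfl)

/-- The machines for `B` and `U` are the two subroutines, indexed by `Bool`. They are called on
degrees, which are at most the number of half-edges, so time polynomial in the number is polynomial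
in the input length. Only planarity needs a witness; the other constraints are checked directly. -/
theorem inNP_variants {B U : Set ℕ} (hB : PseudoPolyTimeDecidable B)
    (hU : PseudoPolyTimeDecidable U) : InNP (trvbBU B U) ∧ InNP (planarTRVB B U) ∧
      InNP (graphTRVB B U) ∧ InNP (planarGraphTRVB B U) := by
  obtain ⟨b, hb, ⟨cb⟩⟩ := hB
  obtain ⟨u, hu, ⟨cu⟩⟩ := hU
  let f : Bool → ℕ → Bool := fun i => bif i then b else u
  let comp : ∀ i, Turing.TM2ComputableInPolyTime Computability.unaryEncodingNat.encode
    Computability.encodeBool (f i) := fun i => match i with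
    | true => cb
    | false => cu
  have hB : PolyPred (ambient f comp) fun k => k ∈ B :=
    ⟨b, PolyFun.call (𝔸 := ambient f comp) true, hb⟩
  have hU : PolyPred (ambient f comp) fun k => k ∈ U :=
    ⟨u, PolyFun.call (𝔸 := ambient f comp) false, hu⟩
  have hD := Data.polyPred_degreesIn hB hU (d := fun d : Data => d) .id
  have hS := Data.polyPred_isSimple (𝔸 := ambient f comp) (d := fun d : Data => d) .id
  have hdeg := fun I : Input => I.degreesIn_iff B U
  have hP := hasWitness_isPlanar (𝔸 := ambient f comp)
  refine ⟨inNP_restrictedTRVB (.of_iff hD hdeg), inNP_restrictedTRVB (.and hD hdeg hP),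
    inNP_restrictedTRVB (.and hD hdeg (.of_iff hS Input.isSimple_iff)),
    inNP_restrictedTRVB (.and hD hdeg ?_)⟩
  obtain ⟨Q, hQ, h⟩ := HasWitness.and hS Input.isSimple_iff hP
  exact ⟨Q, hQ, by simpa only [and_comm] using h⟩

end TRVB

theorem mainTheorem11 :
    TRVB.PolyTimeDecidable (TRVB.pairEncoding TRVB.Symbol) (fun z => TRVB.IsCertificate z.1 z.2) ∧
      TRVB.InNP TRVB.trvb ∧
      ∀ B U : Set ℕ, TRVB.PseudoPolyTimeDecidable B → TRVB.PseudoPolyTimeDecidable U →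
        TRVB.InNP (TRVB.trvbBU B U) ∧ TRVB.InNP (TRVB.planarTRVB B U) ∧
          TRVB.InNP (TRVB.graphTRVB B U) ∧ TRVB.InNP (TRVB.planarGraphTRVB B U) :=
  ⟨TRVB.polyTimeDecidable_of_polyPred (f := fun i : Empty => i.elim) (comp := fun i => i.elim)
    TRVB.polyPred_isCertificate, TRVB.inNP_trvb, fun _ _ hB hU => TRVB.inNP_variants hB hU⟩
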